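/- **Lemma 4.3 (interior BV estimate).** Let $\frac23<\beta<\frac32$, let $v_\beta$ be the unique $\pi$-periodic solution of $$v''+9v=(\beta\cos^2\theta+\sin^2\theta)^{-5/2},$$ and put $K(y)=\dfrac{9\,v_\beta(\theta)}{|y|^3}$ for $y\in\mathbb R^2\setminus\{0\}$ with polar angle $\theta$, and $$\mathcal L u(x)=-\frac1{4\pi}\int_{\mathbb R^2}\big(u(x+y)+u(x-y)-2u(x)\big)K(y)\,dy .$$ For $R>0$ let $B_R\subset\mathbb R^2$ be the ball of radius $R$ centred at the origin and $$\mathcal E(u,B_R)=\iint_{\mathbb R^2\times\mathbb R^2\setminus B_R^c\times B_R^c}|u(x)-u(y)|^2K(x-y)\,dx\,dy .$$ For every $M$ there is a constant $C=C(\beta,M)>0$, depending only on $\beta$ and $M$, such that the following holds. Let $W\in C^2(\mathbb R)$ and let $u:\mathbb R^2\to\mathbb R$ with $|u|\le M$ be a stable solution of the nonlocal equation, that is: * (solution) $u\in C^{1,\gamma}_{\rm loc}(\mathbb R^2)$ for some $\gamma>0$, $\mathcal L u(x)=-\frac1{\sqrt\beta}W'(u(x))$ for every $x\in\mathbb R^2$,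 and $\lim_{x_1\to\pm\infty}u(x_1,x_2)=\pm1$ for every $x_2\in\mathbb R$; * (stability) $\displaystyle\int_{\mathbb R^2}\Big(\mathcal L\eta+\frac1{\sqrt\beta}W''(u)\,\eta\Big)\eta\,dx\ge0$ for every $\eta\in C^2_c(\mathbb R^2)$. Then for every $R\ge1$ the energy $\mathcal E(u,B_R)$ is finite, and for every unit vector $\mathbf v\in S^1$ $$\Big(\int_{B_{1/2}}(\partial_{\mathbf v}u(x))_+\,dx\Big)\Big(\int_{B_{1/2}}(\partial_{\mathbf v}u(y))_-\,dy\Big)\le C\,\frac{\mathcal E(u,B_R)}{R^2},$$ where $f_+=\max\{f,0\}$ and $f_-=-\min\{f,0\}$. Moreover $$\int_{B_{1/2}}|\nabla u(x)|\,dx\le C\Big(1+\sqrt{\mathcal E(u,B_1)}\Big).$$ -/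

import Mathlib

open MeasureTheory Filter Topology

noncomputable section

namespace PeierlsNabarro

/-- The plane `ℝ²` with its Euclidean norm and Lebesgue measure. -/
abbrev Plane := EuclideanSpace ℝ (Fin 2)

/-- The right-hand side `(β cos² θ + sin² θ)^(-5/2)` of the angular equation. -/
def forcing (β θ : ℝ) : ℝ :=
  (β * Real.cos θ ^ 2 + Real.sin θ ^ 2) ^ (-(5 / 2) : ℝ)

/-- `w` is a `π`-periodic solution of `w'' + 9 w = (β cos² θ + sin² θ)^(-5/2)`. -/
def IsAngularProfile (β : ℝ) (w : ℝ → ℝ) : Prop :=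
  ContDiff ℝ 2 w ∧ Function.Periodic w Real.pi ∧
    ∀ θ, deriv (deriv w) θ + 9 * w θ = forcing β θ

/-- The unique `π`-periodic solution of the angular equation, in closed form; see
`isAngularProfile_iff` for existence and uniqueness. -/
def angularProfile (β θ : ℝ) : ℝ :=
  (1 / 6) * ∫ s in (0 : ℝ)..Real.pi, Real.sin (3 * s) * forcing β (θ - s)

theorem forcing_base_pos {β : ℝ} (hβ : 0 < β) (θ : ℝ) :
    0 < β * Real.cos θ ^ 2 + Real.sin θ ^ 2 := by
  have h := Real.sin_sq_add_cos_sq θ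
  rcases eq_or_ne (Real.cos θ) 0 with h0 | h0
  · rw [h0] at h ⊢
    nlinarith
  · have : 0 < β * Real.cos θ ^ 2 := by positivity
    nlinarith [sq_nonneg (Real.sin θ)]

theorem continuous_forcing {β : ℝ} (hβ : 0 < β) : Continuous (forcing β) := by
  unfold forcing
  refine Continuous.rpow_const (by fun_prop) fun θ => Or.inl (forcing_base_pos hβ θ).ne'

theorem forcing_sub_pi (β θ : ℝ) : forcing β (θ - Real.pi) = forcing β θ := by
  simp [forcing, Real.cos_sub_pi, Real.sin_sub_pi]

theorem hasDerivAt_window {g : ℝ → ℝ} (hg : Continuous g) (hgp : ∀ x, g (x - Real.pi) = -g x)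
    (θ : ℝ) : HasDerivAt (fun θ => ∫ x in (θ - Real.pi)..θ, g x) (2 * g θ) θ := by
  have h1 : ∀ t, HasDerivAt (fun t => ∫ x in (0 : ℝ)..t, g x) (g t) t := fun t =>
    intervalIntegral.integral_hasDerivAt_right (hg.intervalIntegrable _ _)
      (hg.stronglyMeasurableAtFilter _ _) hg.continuousAt
  have h2 : HasDerivAt (fun t => ∫ x in (0 : ℝ)..(t - Real.pi), g x) (g (θ - Real.pi)) θ := by
    exact ((h1 (θ - Real.pi)).comp θ ((hasDerivAt_id' θ).sub_const Real.pi)).congr_deriv (mul_one _)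
  have h3 := (h1 θ).sub h2
  rw [hgp] at h3
  have e : (fun θ => ∫ x in (θ - Real.pi)..θ, g x) =
      (fun t => ∫ x in (0 : ℝ)..t, g x) - fun t => ∫ x in (0 : ℝ)..(t - Real.pi), g x := by
    funext t
    simp only [Pi.sub_apply]
    rw [intervalIntegral.integral_interval_sub_left] <;> exact hg.intervalIntegrable _ _
  rw [e]
  exact h3.congr_deriv (by ring)

theorem angularProfile_eq {β : ℝ} (hβ : 0 < β) (θ : ℝ) :
    angularProfile β θ = (1 / 6) *
      (Real.sin (3 * θ) * (∫ x in (θ - Real.pi)..θ, Real.cos (3 * x) * forcing β x) -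
        Real.cos (3 * θ) * ∫ x in (θ - Real.pi)..θ, Real.sin (3 * x) * forcing β x) := by
  have hf := continuous_forcing hβ
  unfold angularProfile
  rw [← intervalIntegral.integral_const_mul (Real.sin (3 * θ)),
    ← intervalIntegral.integral_const_mul (Real.cos (3 * θ)), ← intervalIntegral.integral_sub
      (Continuous.intervalIntegrable (by fun_prop) _ _)
      (Continuous.intervalIntegrable (by fun_prop) _ _)]
  have := intervalIntegral.integral_comp_sub_left
    (fun x => Real.sin (3 * (θ - x)) * forcing β x) θ (a := 0) (b := Real.pi)
  simp only [sub_sub_cancel, sub_zero] at this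
  rw [this]
  congr 1
  refine intervalIntegral.integral_congr fun x _ => ?_
  simp only [mul_sub, Real.sin_sub]
  ring

theorem hasDerivAt_sin_three (θ : ℝ) :
    HasDerivAt (fun θ => Real.sin (3 * θ)) (3 * Real.cos (3 * θ)) θ :=
  ((hasDerivAt_id' θ).const_mul 3).sin.congr_deriv (by ring)

theorem hasDerivAt_cos_three (θ : ℝ) :
    HasDerivAt (fun θ => Real.cos (3 * θ)) (-(3 * Real.sin (3 * θ))) θ :=
  ((hasDerivAt_id' θ).const_mul 3).cos.congr_deriv (by ring)

theorem hasDerivAt_angularProfile {β : ℝ} (hβ : 0 < β) :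
    ∃ w' : ℝ → ℝ, (∀ θ, HasDerivAt (angularProfile β) (w' θ) θ) ∧
      ∀ θ, HasDerivAt w' (forcing β θ - 9 * angularProfile β θ) θ := by
  have hf := continuous_forcing hβ
  have hA := hasDerivAt_window (g := fun x => Real.cos (3 * x) * forcing β x) (by fun_prop)
    (fun x => by
      have : 3 * (x - Real.pi) = 3 * x - Real.pi - 2 * Real.pi := by ring
      rw [this, Real.cos_sub_two_pi, Real.cos_sub_pi, forcing_sub_pi]; ring)
  have hB := hasDerivAt_window (g := fun x => Real.sin (3 * x) * forcing β x) (by fun_prop)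
    (fun x => by
      have : 3 * (x - Real.pi) = 3 * x - Real.pi - 2 * Real.pi := by ring
      rw [this, Real.sin_sub_two_pi, Real.sin_sub_pi, forcing_sub_pi]; ring)
  have hs := hasDerivAt_sin_three
  have hc := hasDerivAt_cos_three
  refine ⟨fun θ => (1 / 2) *
      (Real.cos (3 * θ) * (∫ x in (θ - Real.pi)..θ, Real.cos (3 * x) * forcing β x) +
        Real.sin (3 * θ) * ∫ x in (θ - Real.pi)..θ, Real.sin (3 * x) * forcing β x),
    fun θ => ?_, fun θ => ?_⟩
  · rw [show angularProfile β = _ from funext (angularProfile_eq hβ)]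
    exact ((((hs θ).mul (hA θ)).sub ((hc θ).mul (hB θ))).const_mul (1 / 6)).congr_deriv (by ring)
  · rw [angularProfile_eq hβ]
    refine ((((hc θ).mul (hA θ)).add ((hs θ).mul (hB θ))).const_mul (1 / 2)).congr_deriv ?_
    linear_combination forcing β θ * Real.sin_sq_add_cos_sq (3 * θ)

theorem isAngularProfile_angularProfile {β : ℝ} (hβ : 0 < β) :
    IsAngularProfile β (angularProfile β) := by
  obtain ⟨w', h1, h2⟩ := hasDerivAt_angularProfile hβ
  have e1 : deriv (angularProfile β) = w' := funext fun θ => (h1 θ).deriv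
  have e2 : deriv w' = fun θ => forcing β θ - 9 * angularProfile β θ :=
    funext fun θ => (h2 θ).deriv
  have hcont : Continuous (angularProfile β) :=
    continuous_iff_continuousAt.2 fun θ => (h1 θ).continuousAt
  refine ⟨?_, fun θ => ?_, fun θ => ?_⟩
  · have : ContDiff ℝ (1 + 1) (angularProfile β) := by
      refine contDiff_succ_iff_deriv.2 ⟨fun θ => (h1 θ).differentiableAt, by simp, ?_⟩
      rw [e1]
      refine contDiff_one_iff_deriv.2 ⟨fun θ => (h2 θ).differentiableAt, ?_⟩
      rw [e2]
      exact (continuous_forcing hβ).sub (hcont.const_mul 9)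
    simpa [one_add_one_eq_two] using this
  · unfold angularProfile
    congr 1
    refine intervalIntegral.integral_congr fun s _ => ?_
    have := forcing_sub_pi β (θ + Real.pi - s)
    rw [show θ + Real.pi - s - Real.pi = θ - s by ring] at this
    simp only [this]
  · rw [e1, e2]; ring

theorem isAngularProfile_iff {β : ℝ} (hβ : 0 < β) (w : ℝ → ℝ) :
    IsAngularProfile β w ↔ w = angularProfile β := by
  refine ⟨fun hw => ?_, fun h => h ▸ isAngularProfile_angularProfile hβ⟩
  obtain ⟨v', hv1, hv2⟩ := hasDerivAt_angularProfile hβ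
  obtain ⟨hw0, hwp, hwe⟩ := hw
  have hvp := (isAngularProfile_angularProfile hβ).2.1
  have hw1 : ∀ θ, HasDerivAt w (deriv w θ) θ := fun θ =>
    (hw0.differentiable (by norm_num) θ).hasDerivAt
  have hw2 : ∀ θ, HasDerivAt (deriv w) (deriv (deriv w) θ) θ := fun θ =>
    (((contDiff_succ_iff_deriv (n := 1)).1
      (by simpa [one_add_one_eq_two] using hw0)).2.2.differentiable (by norm_num) θ).hasDerivAt
  set d : ℝ → ℝ := fun θ => w θ - angularProfile β θ with hd
  set d' : ℝ → ℝ := fun θ => deriv w θ - v' θ with hd'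
  have h1 : ∀ θ, HasDerivAt d (d' θ) θ := fun θ => (hw1 θ).sub (hv1 θ)
  have h2 : ∀ θ, HasDerivAt d' (-9 * d θ) θ := fun θ => by
    refine ((hw2 θ).sub (hv2 θ)).congr_deriv ?_
    simp only [hd]
    linear_combination hwe θ
  have hdp : ∀ θ, d (θ + Real.pi) = d θ := fun θ => by simp only [hd, hwp θ, hvp θ]
  have hdp' : ∀ θ, d' (θ + Real.pi) = d' θ := fun θ => by
    have ha : HasDerivAt (fun t => d (t + Real.pi)) (d' (θ + Real.pi)) θ := by
      exact ((h1 (θ + Real.pi)).comp θ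
        ((hasDerivAt_id' θ).add_const Real.pi)).congr_deriv (mul_one _)
    rw [show (fun t => d (t + Real.pi)) = d from funext hdp] at ha
    exact ha.unique (h1 θ)
  have hs := hasDerivAt_sin_three
  have hc := hasDerivAt_cos_three
  have hshift : ∀ θ : ℝ, 3 * (θ + Real.pi) = 3 * θ + Real.pi + 2 * Real.pi := fun θ => by ring
  have hA : ∀ θ, d θ * Real.cos (3 * θ) - d' θ * Real.sin (3 * θ) / 3 = 0 := fun θ => by
    have hder : ∀ t, HasDerivAt
        (fun t => d t * Real.cos (3 * t) - d' t * Real.sin (3 * t) / 3) 0 t := fun t => by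
      exact (((h1 t).mul (hc t)).sub (((h2 t).mul (hs t)).div_const 3)).congr_deriv (by ring)
    have := is_const_of_deriv_eq_zero (fun t => (hder t).differentiableAt)
      (fun t => (hder t).deriv) (θ + Real.pi) θ
    simp only [hdp, hdp', hshift, Real.cos_add_two_pi, Real.sin_add_two_pi, Real.cos_add_pi,
      Real.sin_add_pi] at this
    linarith
  have hB : ∀ θ, d θ * Real.sin (3 * θ) + d' θ * Real.cos (3 * θ) / 3 = 0 := fun θ => by
    have hder : ∀ t, HasDerivAt
        (fun t => d t * Real.sin (3 * t) + d' t * Real.cos (3 * t) / 3) 0 t := fun t => by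
      exact (((h1 t).mul (hs t)).add (((h2 t).mul (hc t)).div_const 3)).congr_deriv (by ring)
    have := is_const_of_deriv_eq_zero (fun t => (hder t).differentiableAt)
      (fun t => (hder t).deriv) (θ + Real.pi) θ
    simp only [hdp, hdp', hshift, Real.cos_add_two_pi, Real.sin_add_two_pi, Real.cos_add_pi,
      Real.sin_add_pi] at this
    linarith
  funext θ
  have : d θ = 0 := by
    linear_combination Real.cos (3 * θ) * hA θ + Real.sin (3 * θ) * hB θ -
      d θ * Real.sin_sq_add_cos_sq (3 * θ)
  exact sub_eq_zero.1 this

/-- The polar angle of a point of the plane, in `(-π, π]`. -/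
def polarAngle (y : Plane) : ℝ := Complex.arg ⟨y 0, y 1⟩

/-- The anisotropic kernel `9 v(θ) / |y|³`, where `θ` is the polar angle of `y`. -/
def kernel (β : ℝ) (y : Plane) : ℝ :=
  9 * angularProfile β (polarAngle y) / ‖y‖ ^ 3

/-- The nonlocal operator
`u ↦ -(1/4π) ∫ (u (x + y) + u (x - y) - 2 u x) K(y) dy`. -/
def nonlocalOp (β : ℝ) (u : Plane → ℝ) (x : Plane) : ℝ :=
  -(1 / (4 * Real.pi)) * ∫ y, (u (x + y) + u (x - y) - 2 * u x) * kernel β y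

/-- The class `C^{1,γ}_loc` for some `γ > 0`: the integral defining `nonlocalOp β u x` converges
absolutely for every bounded function in this class. -/
def IsLocC1Holder (u : Plane → ℝ) : Prop :=
  ContDiff ℝ 1 u ∧ ∃ γ : ℝ, 0 < γ ∧ ∀ R : ℝ, ∃ L : ℝ,
    ∀ x ∈ Metric.ball (0 : Plane) R, ∀ y ∈ Metric.ball (0 : Plane) R,
      ‖fderiv ℝ u x - fderiv ℝ u y‖ ≤ L * ‖x - y‖ ^ γ

/-- `u` is a classical solution of the nonlocal Ginzburg-Landau equation
`L u = -(1/√β) W'(u)` in `ℝ²` with limits `±1` as `x₁ → ±∞`. -/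
structure IsSolution (β : ℝ) (W : ℝ → ℝ) (u : Plane → ℝ) : Prop where
  regular : IsLocC1Holder u
  equation : ∀ x, nonlocalOp β u x = -(1 / √β) * deriv W (u x)
  limit_top : ∀ x₂ : ℝ, Tendsto (fun x₁ : ℝ => u !₂[x₁, x₂]) atTop (𝓝 1)
  limit_bot : ∀ x₂ : ℝ, Tendsto (fun x₁ : ℝ => u !₂[x₁, x₂]) atBot (𝓝 (-1))

/-- Nonnegativity of the second variation of the energy at `u`, tested with `C²` functions of
compact support. -/
def IsStable (β : ℝ) (W : ℝ → ℝ) (u : Plane → ℝ) : Prop :=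
  ∀ η : Plane → ℝ, ContDiff ℝ 2 η → HasCompactSupport η →
    0 ≤ ∫ x, (nonlocalOp β η x + (1 / √β) * deriv (deriv W) (u x) * η x) * η x

/-- The nonlocal energy of `u` in the ball `B_R` centred at the origin:
the integral of `|u x - u y|² K(x - y)` over all pairs that do not both lie outside `B_R`. -/
def energy (β : ℝ) (u : Plane → ℝ) (R : ℝ) : ENNReal :=
  ∫⁻ p in ((Metric.ball (0 : Plane) R)ᶜ ×ˢ (Metric.ball (0 : Plane) R)ᶜ)ᶜ,
    ENNReal.ofReal (|u p.1 - u p.2| ^ 2 * kernel β (p.1 - p.2))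

end PeierlsNabarro

end

noncomputable section

namespace PeierlsNabarro

/-! Write w = ∂_v u, V = W''(u)/√β and κ = 1/(4π). Formally, differentiating the equation gives Lw +
Vw = 0. Testing stability with φ|w| and subtracting this linearised equation tested with φ²w
eliminates V and leaves 2κ ∬ K(y) φ(x)φ(x+y) (|w(x)||w(x+y)| − w(x)w(x+y)) ≤ κ ∬ K(y) (φ(x+y) −
φ(x))² w(x)w(x+y).

On the left the integrand is nonnegative and K is bounded below on |y| < 2. For any weight 0 ≤ θ ≤ φ
supported in the unit disk, the left side therefore dominates a multiple of (∫θ|w|)² − (∫θw)² = 4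
(∫θw₊)(∫θw₋); this is `exists_stability_product_bound`. The range of β enters through the positivity
of K, read off from the closed form `angularProfile_closed_form`.

On the right both factors w are derivatives of increments of u: w(x+y) along (0,v) and, up to sign,
w(x) along (v,−v). Two integrations by parts (`integral_increment_by_parts`) move them onto (φ(x+y)
− φ(x))² K(y). By homogeneity of K the new density is O(‖∇φ‖²_∞ |y|⁻³), so the right side is at most
C‖∇φ‖²_∞ times the energy (`exists_quadratic_increment_le`, `exists_strip_integral_le_energy`). A
cutoff at scale R supplies the factor R⁻².

Taking θ to be the indicator of the half disk gives the product estimate. Taking θ = φ and R = 1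
gives ∫φ|w| ≤ |∫φw| + C√E, where ∫φw = −∫u ∂_vφ is controlled by the bound on u; this is the
gradient estimate.

Three regularisations make this rigorous: |w| becomes √(w² + s), since test functions must be C²; u
is mollified, since its gradient is only continuous and need not be bounded on the plane; K is
truncated near 0 before it is differentiated. `exists_weighted_product_bound` assembles the pieces.
-/

/-! ### Closed form, positivity and smoothness of the kernel. -/

/-- Sextic form whose quotient by `9 β² (β cos² + sin²)^(3/2)` is the angular profile. -/
def profileNum (β a b : ℝ) : ℝ :=
  (3 * β - 2) * b ^ 6 + (9 * β ^ 2 - 12 * β + 6) * (a ^ 2 * b ^ 4) +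
    3 * β * (2 * β ^ 2 - 4 * β + 3) * (a ^ 4 * b ^ 2) + β ^ 2 * (3 - 2 * β) * a ^ 6

/-- All four coefficients are positive: the extreme ones are 3β − 2 and β²(3 − 2β), which is where
both ends of the range of β are used; the middle ones contain (3β − 2)² + 2 and 2(β − 1)² + 1. -/
theorem profileNum_pos {β : ℝ} (h1 : 2 / 3 < β) (h2 : β < 3 / 2) {a b : ℝ}
    (h : a ≠ 0 ∨ b ≠ 0) : 0 < profileNum β a b := by
  have c1 : 0 < 3 * β - 2 := by linarith
  have c2 : 0 < 9 * β ^ 2 - 12 * β + 6 := by nlinarith [sq_nonneg (3 * β - 2)]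
  have c3 : 0 < 3 * β * (2 * β ^ 2 - 4 * β + 3) :=
    mul_pos (by linarith) (by nlinarith [sq_nonneg (β - 1)])
  have c4 : 0 < β ^ 2 * (3 - 2 * β) := mul_pos (by positivity) (by linarith)
  unfold profileNum
  have p1 : 0 ≤ (9 * β ^ 2 - 12 * β + 6) * (a ^ 2 * b ^ 4) := by positivity
  have p2 : 0 ≤ 3 * β * (2 * β ^ 2 - 4 * β + 3) * (a ^ 4 * b ^ 2) :=
    mul_nonneg c3.le (by positivity)
  have p3 : 0 ≤ (3 * β - 2) * b ^ 6 := by positivity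
  have p4 : 0 ≤ β ^ 2 * (3 - 2 * β) * a ^ 6 := mul_nonneg c4.le (by positivity)
  rcases h with h | h
  · have : 0 < β ^ 2 * (3 - 2 * β) * a ^ 6 := mul_pos c4 (by positivity)
    linarith
  · have : 0 < (3 * β - 2) * b ^ 6 := mul_pos c1 (by positivity)
    linarith

/-- The candidate is checked to solve the angular equation and is then identified by the uniqueness
in `isAngularProfile_iff`. With X = cos²θ, e = β − 1 and Q = 1 + eX, the sextic form becomes a cubic
polynomial S(X). -/
theorem angularProfile_closed_form {β : ℝ} (hβ : 0 < β) (θ : ℝ) :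
    angularProfile β θ = profileNum β (Real.cos θ) (Real.sin θ) / (9 * β ^ 2) *
      (β * Real.cos θ ^ 2 + Real.sin θ ^ 2) ^ (-(3 / 2) : ℝ) := by
  set e := β - 1 with he
  set Q : ℝ → ℝ := fun θ => β * Real.cos θ ^ 2 + Real.sin θ ^ 2 with hQ
  have hQpos : ∀ θ, 0 < Q θ := forcing_base_pos hβ
  have hQd : ∀ θ, HasDerivAt Q (-2 * e * Real.sin θ * Real.cos θ) θ := fun θ => by
    refine ((((Real.hasDerivAt_cos θ).pow 2).const_mul β).add
      ((Real.hasDerivAt_sin θ).pow 2)).congr_deriv ?_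
    simp only [he]; push_cast; ring
  have hR : ∀ (r θ : ℝ), HasDerivAt (fun θ => Q θ ^ r)
      ((-2 * e * Real.sin θ * Real.cos θ) * r * Q θ ^ (r - 1)) θ := fun r θ =>
    (hQd θ).rpow_const (Or.inl (hQpos θ).ne')
  set S : ℝ → ℝ := fun X => (3 * β - 2) + 3 * e * (3 * β - 4) * X + 6 * e ^ 2 * (β - 3) * X ^ 2
    - 8 * e ^ 3 * X ^ 3 with hS
  set S' : ℝ → ℝ := fun X => 3 * e * (3 * β - 4) + 12 * e ^ 2 * (β - 3) * X
    - 24 * e ^ 3 * X ^ 2 with hS'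
  set S'' : ℝ → ℝ := fun X => 12 * e ^ 2 * (β - 3) - 48 * e ^ 3 * X with hS''
  have hSd : ∀ X, HasDerivAt S (S' X) X := fun X => by
    have h := hasDerivAt_id' X
    refine ((((h.const_mul (3 * e * (3 * β - 4))).const_add (3 * β - 2)).add
      ((h.pow 2).const_mul (6 * e ^ 2 * (β - 3)))).sub
      ((h.pow 3).const_mul (8 * e ^ 3))).congr_deriv ?_
    simp only [hS']; push_cast; ring
  have hSd' : ∀ X, HasDerivAt S' (S'' X) X := fun X => by
    have h := hasDerivAt_id' X
    refine (((h.const_mul (12 * e ^ 2 * (β - 3))).const_add (3 * e * (3 * β - 4))).sub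
      ((h.pow 2).const_mul (24 * e ^ 3))).congr_deriv ?_
    simp only [hS'']; push_cast; ring
  have hX : ∀ θ, HasDerivAt (fun θ => Real.cos θ ^ 2) (-2 * Real.sin θ * Real.cos θ) θ :=
    fun θ => ((Real.hasDerivAt_cos θ).pow 2).congr_deriv (by push_cast; ring)
  -- The derivative of S·Q^(-3/2) in X is T·Q^(-5/2).
  set T : ℝ → ℝ := fun X => S' X * (1 + e * X) - 3 / 2 * e * S X with hT
  have hTd : ∀ X, HasDerivAt T (S'' X * (1 + e * X) - 1 / 2 * e * S' X) X := fun X => by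
    refine (((hSd' X).mul (((hasDerivAt_id' X).const_mul e).const_add 1)).sub
      ((hSd X).const_mul (3 / 2 * e))).congr_deriv ?_
    ring
  have hq : ∀ θ, Q θ = 1 + e * Real.cos θ ^ 2 := fun θ => by
    simp only [hQ, he]; linear_combination Real.sin_sq_add_cos_sq θ
  have hpow : ∀ (r θ : ℝ), Q θ ^ (r + 1) = Q θ * Q θ ^ r := fun r θ => by
    rw [Real.rpow_add_one (hQpos θ).ne', mul_comm]
  have e3 : ∀ θ, Q θ ^ (-(3 / 2) : ℝ) = Q θ * Q θ ^ (-(5 / 2) : ℝ) := fun θ => by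
    rw [← hpow]; norm_num
  have e5 : ∀ θ, Q θ ^ (-(5 / 2) : ℝ) = Q θ * Q θ ^ (-(7 / 2) : ℝ) := fun θ => by
    rw [← hpow]; norm_num
  set w : ℝ → ℝ := fun θ => S (Real.cos θ ^ 2) * Q θ ^ (-(3 / 2) : ℝ) / (9 * β ^ 2) with hw
  set w' : ℝ → ℝ := fun θ => T (Real.cos θ ^ 2) * Q θ ^ (-(5 / 2) : ℝ) *
    (-2 * (Real.sin θ * Real.cos θ)) / (9 * β ^ 2) with hw'
  have hwd : ∀ θ, HasDerivAt w (w' θ) θ := fun θ => by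
    refine ((((hSd _).comp θ (hX θ)).mul (hR (-(3 / 2)) θ)).div_const _).congr_deriv ?_
    simp only [hw', hT, Function.comp]
    rw [show (-(3 / 2) - 1 : ℝ) = -(5 / 2) by norm_num, e3 θ, hq θ]
    ring
  have hwd' : ∀ θ, HasDerivAt w' (forcing β θ - 9 * w θ) θ := fun θ => by
    refine (((((hTd _).comp θ (hX θ)).mul (hR (-(5 / 2)) θ)).mul
      (((Real.hasDerivAt_sin θ).mul (Real.hasDerivAt_cos θ)).const_mul (-2))).div_const
        (9 * β ^ 2)).congr_deriv ?_
    have hf : forcing β θ = Q θ ^ (-(5 / 2) : ℝ) := rfl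
    have hβ' : β ≠ 0 := hβ.ne'
    have hsin : Real.sin θ ^ 2 = 1 - Real.cos θ ^ 2 := by
      linear_combination Real.sin_sq_add_cos_sq θ
    rw [hf]
    simp only [hw, Function.comp, Pi.mul_apply]
    rw [show (-(5 / 2) - 1 : ℝ) = -(7 / 2) by norm_num, e3 θ, e5 θ, hq θ]
    -- Every power of Q is now a polynomial multiple of Q^(-7/2), so what remains is a polynomial
    -- identity modulo sin² = 1 − cos².
    generalize (1 + e * Real.cos θ ^ 2) ^ (-(7 / 2) : ℝ) = P
    rw [div_eq_iff (by positivity)]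
    have clear_denom : ∀ a b : ℝ, (a - 9 * (b / (9 * β ^ 2))) * (9 * β ^ 2) =
        a * (9 * β ^ 2) - 9 * b := fun a b => by field_simp
    rw [clear_denom]
    simp only [hT, hS, hS', hS'']
    generalize Real.cos θ = c at *
    generalize Real.sin θ = s at *
    have hb : β = e + 1 := by rw [he]; ring
    rw [hb]
    ring_nf
    simp only [hsin]
    ring
  have hprof : IsAngularProfile β w := by
    have d1 : deriv w = w' := funext fun θ => (hwd θ).deriv
    have d2 : deriv w' = fun θ => forcing β θ - 9 * w θ := funext fun θ => (hwd' θ).deriv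
    have hcont : Continuous w := continuous_iff_continuousAt.2 fun θ => (hwd θ).continuousAt
    refine ⟨?_, fun θ => ?_, fun θ => ?_⟩
    · have : ContDiff ℝ (1 + 1) w := by
        refine contDiff_succ_iff_deriv.2 ⟨fun θ => (hwd θ).differentiableAt, by simp, ?_⟩
        rw [d1]
        refine contDiff_one_iff_deriv.2 ⟨fun θ => (hwd' θ).differentiableAt, ?_⟩
        rw [d2]
        exact (continuous_forcing hβ).sub (hcont.const_mul 9)
      simpa [one_add_one_eq_two] using this
    · simp [hw, hQ, Real.cos_add_pi, Real.sin_add_pi]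
    · rw [d1, d2]; ring
  rw [← (isAngularProfile_iff hβ w).1 hprof]
  simp only [hw]
  have : profileNum β (Real.cos θ) (Real.sin θ) = S (Real.cos θ ^ 2) := by
    have hsin : Real.sin θ ^ 2 = 1 - Real.cos θ ^ 2 := by
      linear_combination Real.sin_sq_add_cos_sq θ
    simp only [profileNum, hS, he]
    rw [show Real.sin θ ^ 6 = (Real.sin θ ^ 2) ^ 3 by ring,
      show Real.sin θ ^ 4 = (Real.sin θ ^ 2) ^ 2 by ring, hsin]
    ring
  rw [this]; ring

theorem norm_sq_eq (y : Plane) : ‖y‖ ^ 2 = y 0 ^ 2 + y 1 ^ 2 := by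
  rw [EuclideanSpace.real_norm_sq_eq, Fin.sum_univ_two]

theorem exists_coord_ne_zero {y : Plane} (hy : y ≠ 0) : y 0 ≠ 0 ∨ y 1 ≠ 0 := by
  by_contra! h
  exact hy (by ext i; fin_cases i <;> simp [h.1, h.2])

/-- In Cartesian form the branch cut of the polar angle disappears, which makes smoothness away from
the origin visible. -/
theorem kernel_closed_form {β : ℝ} (hβ : 0 < β) {y : Plane} (hy : y ≠ 0) :
    kernel β y = profileNum β (y 0) (y 1) / (β ^ 2 * (y 0 ^ 2 + y 1 ^ 2) ^ 3) *
      (β * y 0 ^ 2 + y 1 ^ 2) ^ (-(3 / 2) : ℝ) := by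
  have hr : 0 < ‖y‖ := norm_pos_iff.2 hy
  have hz : ‖(⟨y 0, y 1⟩ : ℂ)‖ = ‖y‖ := by
    rw [← sq_eq_sq₀ (norm_nonneg _) (norm_nonneg _), norm_sq_eq, Complex.sq_norm,
      Complex.normSq_mk]
    ring
  have hz0 : (⟨y 0, y 1⟩ : ℂ) ≠ 0 := by rw [← norm_pos_iff, hz]; exact hr
  have hc : Real.cos (polarAngle y) = y 0 / ‖y‖ := by
    rw [polarAngle, Complex.cos_arg hz0, hz]
  have hs : Real.sin (polarAngle y) = y 1 / ‖y‖ := by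
    rw [polarAngle, Complex.sin_arg, hz]
  have hq : 0 < β * y 0 ^ 2 + y 1 ^ 2 := by
    rcases exists_coord_ne_zero hy with h | h <;> positivity
  rw [kernel, angularProfile_closed_form hβ, hc, hs, ← norm_sq_eq]
  have h1 : β * (y 0 / ‖y‖) ^ 2 + (y 1 / ‖y‖) ^ 2 = (β * y 0 ^ 2 + y 1 ^ 2) / ‖y‖ ^ 2 := by
    field_simp
  have h2 : ((β * y 0 ^ 2 + y 1 ^ 2) / ‖y‖ ^ 2) ^ (-(3 / 2) : ℝ) =
      (β * y 0 ^ 2 + y 1 ^ 2) ^ (-(3 / 2) : ℝ) * ‖y‖ ^ 3 := by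
    rw [Real.div_rpow hq.le (by positivity), ← Real.rpow_natCast ‖y‖ 2, ← Real.rpow_mul hr.le,
      div_eq_mul_inv, ← Real.rpow_neg hr.le, ← Real.rpow_natCast ‖y‖ 3]
    norm_num
  rw [h1, h2, profileNum, profileNum]
  field_simp

theorem kernel_zero (β : ℝ) : kernel β 0 = 0 := by simp [kernel]

theorem kernel_pos {β : ℝ} (h1 : 2 / 3 < β) (h2 : β < 3 / 2) {y : Plane} (hy : y ≠ 0) :
    0 < kernel β y := by
  have hβ : 0 < β := by linarith
  have h := profileNum_pos h1 h2 (exists_coord_ne_zero hy)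
  have hq : 0 < β * y 0 ^ 2 + y 1 ^ 2 := by
    rcases exists_coord_ne_zero hy with h | h <;> positivity
  have hq' : 0 < y 0 ^ 2 + y 1 ^ 2 := by
    rcases exists_coord_ne_zero hy with h | h <;> positivity
  rw [kernel_closed_form hβ hy]
  exact mul_pos (div_pos h (by positivity)) (Real.rpow_pos_of_pos hq _)

theorem kernel_nonneg {β : ℝ} (h1 : 2 / 3 < β) (h2 : β < 3 / 2) (y : Plane) :
    0 ≤ kernel β y := by
  rcases eq_or_ne y 0 with rfl | hy
  · rw [kernel_zero]
  · exact (kernel_pos h1 h2 hy).le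

theorem measurable_kernel {β : ℝ} (hβ : 0 < β) : Measurable (kernel β) := by
  have hc : Continuous (angularProfile β) := (isAngularProfile_angularProfile hβ).1.continuous
  have hp : Measurable polarAngle := by
    refine Complex.measurable_arg.comp ?_
    have : (fun y : Plane => (⟨y 0, y 1⟩ : ℂ)) = fun y => (y 0 : ℂ) + (y 1 : ℂ) * Complex.I := by
      funext y; exact Complex.mk_eq_add_mul_I _ _
    rw [this]
    fun_prop
  unfold kernel
  exact ((hc.measurable.comp hp).const_mul 9).div (by fun_prop)

theorem kernel_smul (β : ℝ) {t : ℝ} (ht : 0 < t) (y : Plane) :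
    t ^ 3 * kernel β (t • y) = kernel β y := by
  have hp : polarAngle (t • y) = polarAngle y := by
    have : (⟨(t • y) 0, (t • y) 1⟩ : ℂ) = (t : ℂ) * ⟨y 0, y 1⟩ := by
      apply Complex.ext <;> simp
    rw [polarAngle, this, Complex.arg_real_mul _ ht, polarAngle]
  rcases eq_or_ne y 0 with rfl | hy
  · simp [kernel_zero]
  have hr : ‖y‖ ≠ 0 := norm_ne_zero_iff.2 hy
  rw [kernel, kernel, hp, norm_smul, Real.norm_of_nonneg ht.le]
  field_simp

theorem contDiffAt_kernel {β : ℝ} (hβ : 0 < β) {y : Plane} (hy : y ≠ 0) :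
    ContDiffAt ℝ 2 (kernel β) y := by
  have hq : 0 < β * y 0 ^ 2 + y 1 ^ 2 := by
    rcases exists_coord_ne_zero hy with h | h <;> positivity
  have hq' : 0 < y 0 ^ 2 + y 1 ^ 2 := by
    rcases exists_coord_ne_zero hy with h | h <;> positivity
  have h0 : ContDiffAt ℝ 2 (fun y : Plane => y 0) y := by fun_prop
  have h1 : ContDiffAt ℝ 2 (fun y : Plane => y 1) y := by fun_prop
  have key : ContDiffAt ℝ 2 (fun y : Plane => profileNum β (y 0) (y 1) /
      (β ^ 2 * (y 0 ^ 2 + y 1 ^ 2) ^ 3) * (β * y 0 ^ 2 + y 1 ^ 2) ^ (-(3 / 2) : ℝ)) y := by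
    refine ContDiffAt.mul (ContDiffAt.div ?_ (by fun_prop) (by positivity))
      (ContDiffAt.rpow_const_of_ne (by fun_prop) hq.ne')
    unfold profileNum
    fun_prop
  refine key.congr_of_eventuallyEq ?_
  filter_upwards [isOpen_ne.mem_nhds hy] with z hz
  exact kernel_closed_form hβ hz

/-! ### Homogeneous bounds and truncation of the kernel. -/

section Homogeneous

variable {X : Type*} [NormedAddCommGroup X] [NormedSpace ℝ X]

/-- Homogeneity of degree −d reduces the bound to the maximum over the compact unit circle. -/
theorem exists_bound_of_homogeneous {F : Plane → X} {d : ℕ}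
    (hF : ∀ t : ℝ, 0 < t → ∀ y, t ^ d • F (t • y) = F y) (hc : ContinuousOn F {0}ᶜ) :
    ∃ A : ℝ, 0 ≤ A ∧ ∀ y, y ≠ 0 → ‖F y‖ ≤ A / ‖y‖ ^ d := by
  obtain ⟨A, hA⟩ := (isCompact_sphere (0 : Plane) 1).exists_bound_of_continuousOn
    (hc.mono fun y hy => by
      rintro rfl
      simp at hy)
  refine ⟨max A 0, le_max_right _ _, fun y hy => ?_⟩
  have hr : 0 < ‖y‖ := norm_pos_iff.2 hy
  have h1 := hF ‖y‖⁻¹ (by positivity) y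
  have h2 := hA (‖y‖⁻¹ • y) (by simp [norm_smul, hr.ne'])
  rw [← h1, norm_smul, norm_pow, norm_inv, norm_norm, inv_pow, div_eq_inv_mul]
  gcongr
  exact h2.trans (le_max_left _ _)

set_option maxSynthPendingDepth 3 in
theorem fderiv_homogeneous {F : Plane → X} {d : ℕ}
    (hF : ∀ t : ℝ, 0 < t → ∀ y, t ^ d • F (t • y) = F y) (t : ℝ) (ht : 0 < t) (y : Plane) :
    t ^ (d + 1) • fderiv ℝ F (t • y) = fderiv ℝ F y := by
  have h : (fun y => t ^ d • F (t • y)) = F := funext (hF t ht)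
  conv_rhs => rw [← h]
  change _ = fderiv ℝ (t ^ d • fun y => F (t • y)) y
  rw [fderiv_const_smul_field, Pi.smul_apply, fderiv_comp_smul, smul_smul, pow_succ]

end Homogeneous

/-- Only the annulus 1 ≤ |y| ≤ 2 needs an argument, and there G is bounded by compactness while
|y|^d ≤ 2^d. -/
theorem exists_bound_of_eq_far {X : Type*} [NormedAddCommGroup X] {G F : Plane → X} {A : ℝ} {d : ℕ} (hG : Continuous G)
    (hF : ∀ y, y ≠ 0 → ‖F y‖ ≤ A / ‖y‖ ^ d) (heq : ∀ y, 2 < ‖y‖ → G y = F y)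
    (h0 : ∀ y, ‖y‖ < 1 → G y = 0) :
    ∃ A' : ℝ, 0 ≤ A' ∧ ∀ y, ‖G y‖ ≤ A' / ‖y‖ ^ d := by
  obtain ⟨B, hB⟩ := (isCompact_closedBall (0 : Plane) 2).exists_bound_of_continuousOn
    hG.continuousOn
  have hB0 : 0 ≤ B := (norm_nonneg _).trans (hB 0 (by simp))
  refine ⟨max A (B * 2 ^ d), le_max_of_le_right (by positivity), fun y => ?_⟩
  have hm : 0 ≤ max A (B * 2 ^ d) := le_max_of_le_right (by positivity)
  rcases lt_or_ge ‖y‖ 1 with h | h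
  · rw [h0 y h, norm_zero]; positivity
  have hy : 0 < ‖y‖ := by linarith
  rcases lt_or_ge 2 ‖y‖ with h' | h'
  · rw [heq y h']
    refine (hF y (norm_pos_iff.1 hy)).trans ?_
    gcongr
    exact le_max_left _ _
  · rw [le_div_iff₀ (by positivity)]
    refine le_trans ?_ (le_max_right _ _)
    have := hB y (by simpa using h')
    gcongr

theorem continuousOn_kernel {β : ℝ} (hβ : 0 < β) : ContinuousOn (kernel β) {0}ᶜ := fun _ hy =>
  (contDiffAt_kernel hβ hy).continuousAt.continuousWithinAt

theorem kernel_smul' (β : ℝ) (t : ℝ) (ht : 0 < t) (y : Plane) :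
    t ^ 3 • kernel β (t • y) = kernel β y := kernel_smul β ht y

theorem exists_kernel_le {β : ℝ} (hβ : 0 < β) :
    ∃ A : ℝ, 0 ≤ A ∧ ∀ y, |kernel β y| ≤ A / ‖y‖ ^ 3 := by
  obtain ⟨A, hA0, hA⟩ := exists_bound_of_homogeneous (kernel_smul' β) (continuousOn_kernel hβ)
  refine ⟨A, hA0, fun y => ?_⟩
  rcases eq_or_ne y 0 with rfl | hy
  · simp [kernel_zero]
  · exact hA y hy

/-- A continuous positive function has a positive minimum on the unit circle; homogeneity does the
rest. -/
theorem exists_le_kernel {β : ℝ} (h1 : 2 / 3 < β) (h2 : β < 3 / 2) :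
    ∃ c : ℝ, 0 < c ∧ ∀ y, y ≠ 0 → c / ‖y‖ ^ 3 ≤ kernel β y := by
  have hβ : 0 < β := by linarith
  obtain ⟨z, hz, hmin⟩ := (isCompact_sphere (0 : Plane) 1).exists_isMinOn
    (NormedSpace.sphere_nonempty.2 zero_le_one)
    ((continuousOn_kernel hβ).mono fun y hy => by rintro rfl; simp at hy)
  have hz0 : z ≠ 0 := by rintro rfl; simp at hz
  refine ⟨kernel β z, kernel_pos h1 h2 hz0, fun y hy => ?_⟩
  have hr : 0 < ‖y‖ := norm_pos_iff.2 hy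
  have h3 := kernel_smul β (t := ‖y‖⁻¹) (by positivity) y
  have h4 : kernel β z ≤ kernel β (‖y‖⁻¹ • y) := hmin (by simp [norm_smul, hr.ne'])
  rw [← h3, inv_pow, div_eq_inv_mul]
  gcongr

/-- Smooth radial cutoff, `0` on the unit disk and `1` outside the disk of radius `2`. -/
def radialCutoff (y : Plane) : ℝ := Real.smoothTransition (‖y‖ ^ 2 - 1)

/-- The kernel with its singularity cut off in the unit disk. -/
def cutKernel (β : ℝ) (y : Plane) : ℝ := radialCutoff y * kernel β y

theorem radialCutoff_mem (y : Plane) : 0 ≤ radialCutoff y ∧ radialCutoff y ≤ 1 :=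
  ⟨Real.smoothTransition.nonneg _, Real.smoothTransition.le_one _⟩

theorem cutKernel_of_le {β : ℝ} {y : Plane} (hy : ‖y‖ ≤ 1) : cutKernel β y = 0 := by
  rw [cutKernel, radialCutoff, Real.smoothTransition.zero_of_nonpos, zero_mul]
  nlinarith [norm_nonneg y]

theorem cutKernel_of_ge {β : ℝ} {y : Plane} (hy : 3 / 2 ≤ ‖y‖) : cutKernel β y = kernel β y := by
  rw [cutKernel, radialCutoff, Real.smoothTransition.one_of_one_le, one_mul]
  nlinarith

theorem contDiff_cutKernel {β : ℝ} (hβ : 0 < β) : ContDiff ℝ 2 (cutKernel β) := by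
  rw [contDiff_iff_contDiffAt]
  intro y
  rcases eq_or_ne y 0 with rfl | hy
  · refine (contDiffAt_const (c := (0 : ℝ))).congr_of_eventuallyEq ?_
    filter_upwards [Metric.ball_mem_nhds (0 : Plane) one_pos] with y hy
    exact cutKernel_of_le (by simpa using (mem_ball_zero_iff.1 hy).le)
  · refine ContDiffAt.mul ?_ (contDiffAt_kernel hβ hy)
    exact Real.smoothTransition.contDiffAt.comp y
      ((contDiff_norm_sq ℝ).contDiffAt.sub contDiffAt_const)

-- The first two derivatives of K are homogeneous of degrees −4 and −5, and the cutoff alters them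
-- only in a bounded region, with value zero near the origin.
set_option maxSynthPendingDepth 3 in
theorem exists_cutKernel_bounds {β : ℝ} (hβ : 0 < β) :
    ∃ A : ℝ, 0 ≤ A ∧ ∀ y, |cutKernel β y| ≤ A / ‖y‖ ^ 3 ∧
      ‖fderiv ℝ (cutKernel β) y‖ ≤ A / ‖y‖ ^ 4 ∧
      ‖fderiv ℝ (fderiv ℝ (cutKernel β)) y‖ ≤ A / ‖y‖ ^ 5 := by
  have hcd := contDiff_cutKernel hβ
  have hcd1 : ContDiff ℝ 1 (fderiv ℝ (cutKernel β)) := hcd.fderiv_right (by norm_num)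
  have hK1 : ∀ y : Plane, y ≠ 0 → ContDiffAt ℝ 1 (fderiv ℝ (kernel β)) y := fun y hy =>
    (contDiffAt_kernel hβ hy).fderiv_right (by norm_num)
  have hK2 : ∀ y : Plane, y ≠ 0 → ContDiffAt ℝ 0 (fderiv ℝ (fderiv ℝ (kernel β))) y :=
    fun y hy => (hK1 y hy).fderiv_right (by norm_num)
  have hom1 := fderiv_homogeneous (kernel_smul' β)
  have hom2 := fderiv_homogeneous hom1
  obtain ⟨B0, -, hB0⟩ := exists_bound_of_homogeneous (kernel_smul' β) (continuousOn_kernel hβ)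
  obtain ⟨B1, -, hB1⟩ := exists_bound_of_homogeneous hom1
    fun y hy => (hK1 y hy).continuousAt.continuousWithinAt
  obtain ⟨B2, -, hB2⟩ := exists_bound_of_homogeneous hom2
    fun y hy => (hK2 y hy).continuousAt.continuousWithinAt
  have far : ∀ y : Plane, 2 < ‖y‖ → cutKernel β =ᶠ[𝓝 y] kernel β := fun y hy => by
    filter_upwards [(isOpen_lt continuous_const continuous_norm).mem_nhds hy] with z hz
    exact cutKernel_of_ge (by linarith [show 2 < ‖z‖ from hz])
  have near : ∀ y : Plane, ‖y‖ < 1 → cutKernel β =ᶠ[𝓝 y] fun _ => (0 : ℝ) := fun y hy => by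
    filter_upwards [(isOpen_lt continuous_norm continuous_const).mem_nhds hy] with z hz
    exact cutKernel_of_le (le_of_lt hz)
  have near' : ∀ y : Plane, ‖y‖ < 1 → fderiv ℝ (cutKernel β) =ᶠ[𝓝 y] fun _ => 0 := fun y hy => by
    filter_upwards [(near y hy).fderiv (𝕜 := ℝ)] with z hz
    simpa using hz
  obtain ⟨A0, hA0, h0⟩ := exists_bound_of_eq_far hcd.continuous hB0
    (fun y hy => (far y hy).eq_of_nhds) (fun y hy => (near y hy).eq_of_nhds)
  obtain ⟨A1, hA1, h1⟩ := exists_bound_of_eq_far hcd1.continuous hB1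
    (fun y hy => (far y hy).fderiv_eq) (fun y hy => (near' y hy).eq_of_nhds)
  obtain ⟨A2, hA2, h2⟩ := exists_bound_of_eq_far
    (hcd1.continuous_fderiv (by norm_num)) hB2
    (fun y hy => (far y hy).fderiv.fderiv_eq)
    (fun y hy => by rw [(near' y hy).fderiv_eq]; simp)
  refine ⟨A0 + A1 + A2, by positivity, fun y => ⟨(h0 y).trans ?_, (h1 y).trans ?_,
    (h2 y).trans ?_⟩⟩ <;> gcongr <;> linarith

set_option maxSynthPendingDepth 3 in
/-- The kernel admits `C²` truncations near the origin whose derivatives have the same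
homogeneous bounds, uniformly in the truncation scale. -/
theorem exists_truncated_kernel {β : ℝ} (h1 : 2 / 3 < β) (h2 : β < 3 / 2) :
    ∃ A : ℝ, 0 ≤ A ∧ ∀ τ : ℝ, 0 < τ → ∃ k : Plane → ℝ, ContDiff ℝ 2 k ∧
      (∀ y, 0 ≤ k y ∧ k y ≤ kernel β y) ∧ (∀ y, 2 * τ ≤ ‖y‖ → k y = kernel β y) ∧
      (∀ y, ‖y‖ < τ → k y = 0) ∧
      (∀ y, |k y| ≤ A / ‖y‖ ^ 3 ∧ ‖fderiv ℝ k y‖ ≤ A / ‖y‖ ^ 4 ∧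
        ‖fderiv ℝ (fderiv ℝ k) y‖ ≤ A / ‖y‖ ^ 5) := by
  have hβ : 0 < β := by linarith
  obtain ⟨A, hA, hb⟩ := exists_cutKernel_bounds hβ
  refine ⟨A, hA, fun τ hτ => ?_⟩
  -- The truncation is s³ · `cutKernel`(s y). Homogeneity of K makes it a cutoff times K itself,
  -- hence between 0 and K, and the bounds A/|y|^d are invariant under this rescaling, so A does not
  -- depend on τ.
  set s := τ⁻¹ with hs
  have hs0 : 0 < s := by positivity
  have hd1 : fderiv ℝ (fun y => s ^ 3 * cutKernel β (s • y)) =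
      fun y => s ^ 4 • fderiv ℝ (cutKernel β) (s • y) := by
    funext y
    change fderiv ℝ (s ^ 3 • fun y => cutKernel β (s • y)) y = _
    rw [fderiv_const_smul_field, Pi.smul_apply, fderiv_comp_smul, smul_smul, ← pow_succ]
  have hd2 : fderiv ℝ (fun y => s ^ 4 • fderiv ℝ (cutKernel β) (s • y)) =
      fun y => s ^ 5 • fderiv ℝ (fderiv ℝ (cutKernel β)) (s • y) := by
    funext y
    change fderiv ℝ (s ^ 4 • fun y => fderiv ℝ (cutKernel β) (s • y)) y = _
    rw [fderiv_const_smul_field, Pi.smul_apply, fderiv_comp_smul, smul_smul, ← pow_succ]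
  have hn : ∀ y : Plane, ‖s • y‖ = s * ‖y‖ := fun y => by
    rw [norm_smul, Real.norm_of_nonneg hs0.le]
  have scale : ∀ (d : ℕ) (y : Plane), s ^ d * (A / ‖s • y‖ ^ d) = A / ‖y‖ ^ d := fun d y => by
    rw [hn, mul_pow, ← mul_div_assoc, mul_div_mul_left _ _ (by positivity)]
  have hval : ∀ y, s ^ 3 * cutKernel β (s • y) = radialCutoff (s • y) * kernel β y := fun y => by
    rw [cutKernel, ← kernel_smul β hs0 y]; ring
  refine ⟨fun y => s ^ 3 * cutKernel β (s • y), ?_, fun y => ?_, fun y hy => ?_, fun y hy => ?_,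
    fun y => ⟨?_, ?_, ?_⟩⟩
  · exact contDiff_const.mul ((contDiff_cutKernel hβ).comp (contDiff_const_smul s))
  · simp only [hval]
    obtain ⟨ha, hb⟩ := radialCutoff_mem (s • y)
    have := kernel_nonneg h1 h2 y
    exact ⟨by positivity, mul_le_of_le_one_left this hb⟩
  · simp only
    rw [cutKernel_of_ge, kernel_smul β hs0]
    rw [hn, hs, ← div_eq_inv_mul, le_div_iff₀ hτ]
    linarith
  · simp only
    rw [cutKernel_of_le, mul_zero]
    rw [hn, hs, ← div_eq_inv_mul, div_le_iff₀ hτ]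
    linarith
  · simp only
    rw [abs_mul, abs_of_pos (by positivity : 0 < s ^ 3), ← scale]
    gcongr
    exact (hb _).1
  · rw [hd1]
    simp only
    rw [norm_smul, Real.norm_of_nonneg (by positivity), ← scale]
    gcongr
    exact (hb _).2.1
  · rw [hd1, hd2]
    simp only
    rw [norm_smul, Real.norm_of_nonneg (by positivity), ← scale]
    gcongr
    exact (hb _).2.2

/-! ### Second differences and the weak form of the operator. -/

/-- The weight `min (|y| ^ (1 + γ)) 1 / |y| ^ 3`, integrable on the plane for `γ > 0`. -/
def cubicWeight (γ : ℝ) (y : Plane) : ℝ := min (‖y‖ ^ (1 + γ)) 1 / ‖y‖ ^ 3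

theorem cubicWeight_nonneg (γ : ℝ) (y : Plane) : 0 ≤ cubicWeight γ y :=
  div_nonneg (le_min (Real.rpow_nonneg (norm_nonneg _) _) zero_le_one) (by positivity)

/-- In polar coordinates the radial density is r^(γ−1) on (0,1] and r⁻² on (1,∞). -/
theorem integrable_cubicWeight {γ : ℝ} (hγ : 0 < γ) : Integrable (cubicWeight γ) := by
  have h := (integrable_fun_norm_addHaar (E := Plane) (μ := volume)
    (f := fun r : ℝ => min (r ^ (1 + γ)) 1 / r ^ 3)).2 ?_
  · exact h
  have hfin : Module.finrank ℝ Plane = 2 := by simp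
  rw [hfin, ← Set.Ioc_union_Ioi_eq_Ioi zero_le_one]
  refine IntegrableOn.union ?_ ?_
  · have : IntegrableOn (fun r : ℝ => r ^ (γ - 1)) (Set.Ioc 0 1) := by
      rw [← intervalIntegrable_iff_integrableOn_Ioc_of_le zero_le_one]
      exact intervalIntegral.intervalIntegrable_rpow' (by linarith)
    refine this.congr_fun (fun r hr => ?_) measurableSet_Ioc
    have hr0 : 0 < r := hr.1
    have h1 : r ^ (1 + γ) ≤ 1 := Real.rpow_le_one hr0.le hr.2 (by linarith)
    simp only [smul_eq_mul, min_eq_left h1]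
    rw [show γ - 1 = (1 + γ) - 2 by ring, Real.rpow_sub hr0]
    norm_num
    field_simp
  · have : IntegrableOn (fun r : ℝ => r ^ (-2 : ℝ)) (Set.Ioi 1) :=
      integrableOn_Ioi_rpow_of_lt (by norm_num) one_pos
    refine this.congr_fun (fun r hr => ?_) measurableSet_Ioi
    have hr1 : 1 < r := hr
    have hr0 : 0 < r := by linarith
    have h1 : 1 ≤ r ^ (1 + γ) := Real.one_le_rpow hr1.le (by linarith)
    simp only [smul_eq_mul, min_eq_right h1]
    rw [Real.rpow_neg hr0.le]
    norm_num
    field_simp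

/-- The second difference `u (x + y) + u (x - y) - 2 u x`. -/
def secondDiff (u : Plane → ℝ) (x y : Plane) : ℝ := u (x + y) + u (x - y) - 2 * u x

/-- For |y| < 1, the function t ↦ u(x+ty) + u(x−ty) has derivative (∇u(x+ty) − ∇u(x−ty))·y, taken at
points 2t|y| apart, so Hölder continuity of the gradient gives O(|y|^(1+γ)). For |y| ≥ 1 the crude
bound 4M is enough. -/
theorem secondDiff_bound {u : Plane → ℝ} (hu : IsLocC1Holder u) {M : ℝ} (hM : ∀ x, |u x| ≤ M)
    (R : ℝ) : ∃ γ : ℝ, 0 < γ ∧ ∃ C : ℝ, 0 ≤ C ∧ ∀ x ∈ Metric.ball (0 : Plane) R, ∀ y,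
      |secondDiff u x y| ≤ C * min (‖y‖ ^ (1 + γ)) 1 := by
  obtain ⟨hu1, γ, hγ, hL⟩ := hu
  obtain ⟨L, hL⟩ := hL (R + 1)
  have hM0 : 0 ≤ M := (abs_nonneg _).trans (hM 0)
  -- The Hölder constant supplied by the hypothesis carries no sign.
  set L' := max L 0 with hL'
  refine ⟨γ, hγ, max (4 * M) (L' * 2 ^ γ), le_max_of_le_left (by positivity), fun x hx y => ?_⟩
  have hC0 : 0 ≤ max (4 * M) (L' * 2 ^ γ) := le_max_of_le_left (by positivity)
  rcases le_or_gt 1 ‖y‖ with hy | hy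
  · rw [min_eq_right (Real.one_le_rpow hy (by linarith)), mul_one]
    refine le_trans ?_ (le_max_left _ _)
    have h1 := abs_le.1 (hM (x + y))
    have h2 := abs_le.1 (hM (x - y))
    have h3 := abs_le.1 (hM x)
    rw [secondDiff, abs_le]
    constructor <;> linarith
  rw [min_eq_left (Real.rpow_le_one (norm_nonneg _) hy.le (by linarith))]
  have hd : ∀ z, HasFDerivAt u (fderiv ℝ u z) z := fun z =>
    (hu1.differentiable (by norm_num) z).hasFDerivAt
  have hder : ∀ t : ℝ, HasDerivAt (fun t : ℝ => u (x + t • y) + u (x - t • y))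
      (fderiv ℝ u (x + t • y) y - fderiv ℝ u (x - t • y) y) t := fun t => by
    have a1 : HasDerivAt (fun t : ℝ => x + t • y) y t := by
      simpa using ((hasDerivAt_id t).smul_const y).const_add x
    have a2 : HasDerivAt (fun t : ℝ => x - t • y) (-y) t := by
      simpa using ((hasDerivAt_id t).smul_const y).const_sub x
    have := ((hd _).comp_hasDerivAt t a1).add ((hd _).comp_hasDerivAt t a2)
    refine this.congr_deriv ?_
    simp [sub_eq_add_neg]
  have hmem : ∀ t ∈ Set.Ico (0 : ℝ) 1, ∀ e : ℝ, |e| = 1 →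
      x + (e * t) • y ∈ Metric.ball (0 : Plane) (R + 1) := fun t ht e he => by
    rw [mem_ball_zero_iff] at hx ⊢
    refine (norm_add_le _ _).trans_lt ?_
    rw [norm_smul, Real.norm_eq_abs, abs_mul, he, one_mul, abs_of_nonneg ht.1]
    nlinarith [ht.1, ht.2, norm_nonneg y]
  have := norm_image_sub_le_of_norm_deriv_le_segment_01' (C := L' * 2 ^ γ * ‖y‖ ^ (1 + γ))
    (fun t _ => (hder t).hasDerivWithinAt) (fun t ht => ?_)
  · simp only [one_smul, zero_smul, add_zero, sub_zero, Real.norm_eq_abs] at this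
    rw [show u (x + y) + u (x - y) - (u x + u x) = secondDiff u x y by
      rw [secondDiff]; ring] at this
    refine this.trans ?_
    gcongr
    exact le_max_right _ _
  · rw [← sub_apply]
    refine (ContinuousLinearMap.le_opNorm _ _).trans ?_
    have h1 := hL _ (by simpa using hmem t ht 1 (by simp)) _
      (by simpa [← sub_eq_add_neg] using hmem t ht (-1) (by simp))
    have h2 : ‖x + t • y - (x - t • y)‖ = 2 * t * ‖y‖ := by
      rw [show x + t • y - (x - t • y) = (2 * t) • y by module, norm_smul,
        Real.norm_of_nonneg (by linarith [ht.1])]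
    rw [h2] at h1
    have h3 : (2 * t * ‖y‖) ^ γ ≤ 2 ^ γ * ‖y‖ ^ γ := by
      rw [← Real.mul_rpow (by norm_num) (norm_nonneg _)]
      refine Real.rpow_le_rpow (by have := ht.1; positivity) ?_ hγ.le
      nlinarith [ht.1, ht.2, norm_nonneg y]
    have h4 : ‖y‖ ^ (1 + γ) ≥ ‖y‖ ^ γ * ‖y‖ := by
      rcases eq_or_lt_of_le (norm_nonneg y) with h | h
      · rw [← h, mul_zero]; exact Real.rpow_nonneg le_rfl _
      · rw [add_comm, Real.rpow_add_one h.ne']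
    have h5 : L * (2 * t * ‖y‖) ^ γ ≤ L' * (2 ^ γ * ‖y‖ ^ γ) := by
      have := ht.1
      calc L * (2 * t * ‖y‖) ^ γ ≤ L' * (2 * t * ‖y‖) ^ γ := by
            gcongr; exact le_max_left _ _
        _ ≤ _ := by gcongr
    calc _ ≤ L' * (2 ^ γ * ‖y‖ ^ γ) * ‖y‖ := by gcongr; exact h1.trans h5
      _ = L' * 2 ^ γ * (‖y‖ ^ γ * ‖y‖) := by ring
      _ ≤ _ := by gcongr

theorem isLocC1Holder_of_contDiff {u : Plane → ℝ} (hu : ContDiff ℝ 2 u) : IsLocC1Holder u := by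
  refine ⟨hu.of_le (by norm_num), 1, one_pos, fun R => ?_⟩
  have hu1 : ContDiff ℝ 1 (fderiv ℝ u) := hu.fderiv_right (by norm_num)
  obtain ⟨L, hL⟩ := (isCompact_closedBall (0 : Plane) R).exists_bound_of_continuousOn
    (hu1.continuous_fderiv (by norm_num)).continuousOn
  refine ⟨L, fun x hx y hy => ?_⟩
  rw [Real.rpow_one]
  exact (convex_ball (0 : Plane) R).norm_image_sub_le_of_norm_fderiv_le
    (fun z _ => hu1.differentiable (by norm_num) z)
    (fun z hz => hL z (Metric.ball_subset_closedBall hz)) hy hx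

/-- The integral over `x` of the product of the increments by `y` of two functions. -/
def incrementForm (η ζ : Plane → ℝ) (y : Plane) : ℝ :=
  ∫ x, (η (x + y) - η x) * (ζ (x + y) - ζ x)

theorem hasCompactSupport_comp_add_right {ζ : Plane → ℝ} (hζ : HasCompactSupport ζ) (y : Plane) :
    HasCompactSupport fun x => ζ (x + y) :=
  hζ.comp_homeomorph (Homeomorph.addRight y)

theorem integrable_mul_of_hasCompactSupport {f ζ : Plane → ℝ} (hf : Continuous f)
    (hζc : Continuous ζ) (hζ : HasCompactSupport ζ) : Integrable fun x => f x * ζ x :=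
  (hf.mul hζc).integrable_of_hasCompactSupport hζ.mul_left

/-- Discrete integration by parts: the second difference is a forward increment minus a backward
one, and translating the backward one by y moves the increment onto ζ. -/
theorem integral_secondDiff_mul {η ζ : Plane → ℝ} (hη : Continuous η) (hζc : Continuous ζ)
    (hζ : HasCompactSupport ζ) (y : Plane) :
    ∫ x, secondDiff η x y * ζ x = -incrementForm η ζ y := by
  have i1 : Integrable fun x => (η (x + y) - η x) * ζ x :=
    integrable_mul_of_hasCompactSupport (by fun_prop) hζc hζ
  have i2 : Integrable fun x => (η x - η (x - y)) * ζ x :=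
    integrable_mul_of_hasCompactSupport (by fun_prop) hζc hζ
  have i3 : Integrable fun x => (η (x + y) - η x) * ζ (x + y) :=
    integrable_mul_of_hasCompactSupport (by fun_prop) (by fun_prop)
      (hasCompactSupport_comp_add_right hζ y)
  have e : ∫ x, (η x - η (x - y)) * ζ x = ∫ x, (η (x + y) - η x) * ζ (x + y) := by
    rw [← integral_add_right_eq_self _ y]
    simp
  calc ∫ x, secondDiff η x y * ζ x
      = ∫ x, ((η (x + y) - η x) * ζ x - (η x - η (x - y)) * ζ x) := by
        congr 1; funext x; rw [secondDiff]; ring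
    _ = (∫ x, (η (x + y) - η x) * ζ x) - ∫ x, (η (x + y) - η x) * ζ (x + y) := by
        rw [integral_sub i1 i2, e]
    _ = -incrementForm η ζ y := by
        rw [incrementForm, ← integral_sub i1 i3, ← integral_neg]
        congr 1; funext x; ring

theorem measurable_secondDiff {η : Plane → ℝ} (hη : Continuous η) :
    Measurable fun p : Plane × Plane => secondDiff η p.1 p.2 := by
  unfold secondDiff
  exact Continuous.measurable (by fun_prop)

/-- On the support of ζ the second difference is O(min(|y|^(1+γ), 1)), so the integrand is dominated
by a product of integrable functions of x and y. This is what permits Fubini in `weak_form` and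
`nonlocalOp_convolution`. -/
theorem integrable_secondDiff_prod {K : Plane → ℝ} (hKm : Measurable K) {A : ℝ}
    (hK : ∀ y, |K y| ≤ A / ‖y‖ ^ 3) {η ζ : Plane → ℝ} (hη : IsLocC1Holder η) {M : ℝ}
    (hM : ∀ x, |η x| ≤ M) (hζc : Continuous ζ) (hζ : HasCompactSupport ζ) :
    Integrable (fun p : Plane × Plane => secondDiff η p.1 p.2 * K p.2 * ζ p.1)
      (volume.prod volume) := by
  obtain ⟨R, hR⟩ := hζ.isCompact.isBounded.subset_ball 0
  obtain ⟨γ, hγ, C, hC, hb⟩ := secondDiff_bound hη hM R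
  have hdom : Integrable (fun p : Plane × Plane => |ζ p.1| * (C * A * cubicWeight γ p.2))
      (volume.prod volume) :=
    (hζc.integrable_of_hasCompactSupport hζ).abs.mul_prod
      ((integrable_cubicWeight hγ).const_mul _)
  refine hdom.mono' ?_ (Eventually.of_forall fun p => ?_)
  · exact (((measurable_secondDiff hη.1.continuous).mul (hKm.comp measurable_snd)).mul
      (hζc.measurable.comp measurable_fst)).aestronglyMeasurable
  · rw [Real.norm_eq_abs, abs_mul, abs_mul]
    by_cases hx : ζ p.1 = 0
    · simp [hx]
    have h1 := hb p.1 (hR (subset_tsupport _ hx)) p.2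
    have h2 := hK p.2
    calc |secondDiff η p.1 p.2| * |K p.2| * |ζ p.1|
        ≤ (C * min (‖p.2‖ ^ (1 + γ)) 1) * (A / ‖p.2‖ ^ 3) * |ζ p.1| := by gcongr
      _ = _ := by rw [cubicWeight]; ring

theorem weak_form {K : Plane → ℝ} (hKm : Measurable K) {A : ℝ}
    (hK : ∀ y, |K y| ≤ A / ‖y‖ ^ 3) {η ζ : Plane → ℝ} (hη : IsLocC1Holder η) {M : ℝ}
    (hM : ∀ x, |η x| ≤ M) (hζc : Continuous ζ) (hζ : HasCompactSupport ζ) :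
    Integrable (fun x => (∫ y, secondDiff η x y * K y) * ζ x) ∧
      Integrable (fun y => K y * incrementForm η ζ y) ∧
      ∫ x, (∫ y, secondDiff η x y * K y) * ζ x = -∫ y, K y * incrementForm η ζ y := by
  have hi := integrable_secondDiff_prod hKm hK hη hM hζc hζ
  have e1 : ∀ x, ∫ y, secondDiff η x y * K y * ζ x = (∫ y, secondDiff η x y * K y) * ζ x :=
    fun x => integral_mul_const _ _
  have e2 : ∀ y, ∫ x, secondDiff η x y * K y * ζ x = -(K y * incrementForm η ζ y) := fun y => by
    rw [← mul_neg, ← integral_secondDiff_mul hη.1.continuous hζc hζ, ← integral_const_mul]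
    congr 1; funext x; ring
  refine ⟨?_, ?_, ?_⟩
  · simpa only [e1] using hi.integral_prod_left
  · simpa only [e2, integrable_neg_iff, ← Pi.neg_def] using hi.integral_prod_right
  · rw [← integral_neg]
    simp only [← e1, ← e2]
    exact integral_integral_swap hi

/-! ### Double integration by parts for the increment form. -/

/-- Pairs `(x, y)` such that `x` or `x + y` lies in the ball of radius `r`. -/
def strip (r : ℝ) : Set (Plane × Plane) :=
  {p | p.1 ∈ Metric.ball (0 : Plane) r ∨ p.1 + p.2 ∈ Metric.ball (0 : Plane) r}

theorem measurableSet_strip (r : ℝ) : MeasurableSet (strip r) := by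
  have : IsOpen (strip r) := (Metric.isOpen_ball.preimage continuous_fst).union
    (Metric.isOpen_ball.preimage (continuous_fst.add continuous_snd))
  exact this.measurableSet

/-- For fixed y the admissible x lie in a union of two disks of radius r. The disk for x + y is
carried to the disk for x by a measure-preserving shear. -/
theorem integrableOn_strip {h : Plane → ℝ} (hh : Integrable h) (r : ℝ) :
    IntegrableOn (fun p : Plane × Plane => h p.2) (strip r) (volume.prod volume) := by
  have key : IntegrableOn (fun p : Plane × Plane => h p.2)
      (Metric.ball (0 : Plane) r ×ˢ Set.univ) (volume.prod volume) := by
    rw [IntegrableOn, ← Measure.prod_restrict, Measure.restrict_univ]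
    have : IsFiniteMeasure (volume.restrict (Metric.ball (0 : Plane) r)) :=
      isFiniteMeasure_restrict.2 measure_ball_lt_top.ne
    exact hh.comp_snd _
  have hmp := measurePreserving_add_prod (volume : Measure Plane) (volume : Measure Plane)
  have hemb : MeasurableEmbedding fun z : Plane × Plane => (z.1 + z.2, z.2) :=
    (Homeomorph.measurableEmbedding
      ⟨⟨fun z : Plane × Plane => (z.1 + z.2, z.2), fun z => (z.1 - z.2, z.2),
        fun z => by simp, fun z => by simp⟩, by fun_prop, by fun_prop⟩)
  have key2 := (hmp.integrableOn_comp_preimage hemb).2 key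
  exact (key.union key2).mono_set fun p hp => hp.imp (fun h => ⟨h, trivial⟩) fun h => ⟨h, trivial⟩

theorem integrable_of_strip_bound {F : Plane × Plane → ℝ} {h : Plane → ℝ} {r : ℝ}
    (hF : AEStronglyMeasurable F (volume.prod volume)) (hh : Integrable h)
    (h0 : ∀ p, p ∉ strip r → F p = 0) (hb : ∀ p, |F p| ≤ h p.2) :
    Integrable F (volume.prod volume) := by
  refine ((integrableOn_strip hh r).integrable_indicator (measurableSet_strip r)).mono' hF
    (Eventually.of_forall fun p => ?_)
  by_cases hp : p ∈ strip r
  · rw [Set.indicator_of_mem hp]; exact hb p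
  · rw [Set.indicator_of_notMem hp, h0 p hp, norm_zero]

/-- Mixed second derivative of `(φ (x + y) - φ x)² k y` in the directions `(0, v)` and `(v, -v)`. -/
def mixedDeriv (φ φ' k k' k'' : Plane → ℝ) (p : Plane × Plane) : ℝ :=
  -2 * φ' p.1 * φ' (p.1 + p.2) * k p.2 - 2 * (φ (p.1 + p.2) - φ p.1) * φ' (p.1 + p.2) * k' p.2
    - 2 * (φ (p.1 + p.2) - φ p.1) * φ' p.1 * k' p.2 - (φ (p.1 + p.2) - φ p.1) ^ 2 * k'' p.2

/-- Both derivatives of u are traded for derivatives of D²k, where D is the increment of φ, so that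
only the squared increment of u survives. The right-hand side contains no derivative of u, so the
bound B on w serves integrability only. -/
theorem integral_increment_by_parts {u w φ φ' k k' k'' h : Plane → ℝ} {v : Plane} {r : ℝ}
    (hu : ∀ x, HasLineDerivAt ℝ u (w x) x v) (hφ : ∀ x, HasLineDerivAt ℝ φ (φ' x) x v)
    (hk : ∀ x, HasLineDerivAt ℝ k (k' x) x v) (hk' : ∀ x, HasLineDerivAt ℝ k' (k'' x) x v)
    (cu : Continuous u) (cw : Continuous w) (cφ : Continuous φ) (cφ' : Continuous φ')
    (ck : Continuous k) (ck' : Continuous k') (ck'' : Continuous k'')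
    {M B Φ Λ : ℝ} (bu : ∀ x, |u x| ≤ M) (bw : ∀ x, |w x| ≤ B) (bφ : ∀ x, |φ x| ≤ Φ)
    (bφ' : ∀ x, |φ' x| ≤ Λ) (hh : Integrable h) (bk : ∀ y, |k y| ≤ h y) (bk' : ∀ y, |k' y| ≤ h y)
    (bk'' : ∀ y, |k'' y| ≤ h y) (sφ : ∀ x, x ∉ Metric.ball (0 : Plane) r → φ x = 0)
    (sφ' : ∀ x, x ∉ Metric.ball (0 : Plane) r → φ' x = 0) :
    ∫ p : Plane × Plane, k p.2 * (φ (p.1 + p.2) - φ p.1) ^ 2 * (w p.1 * w (p.1 + p.2))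
        ∂(volume.prod volume) =
      -(1 / 2) * ∫ p : Plane × Plane, mixedDeriv φ φ' k k' k'' p * (u (p.1 + p.2) - u p.1) ^ 2
        ∂(volume.prod volume) := by
  have hM : 0 ≤ M := (abs_nonneg _).trans (bu 0)
  have hB : 0 ≤ B := (abs_nonneg _).trans (bw 0)
  have hΦ : 0 ≤ Φ := (abs_nonneg _).trans (bφ 0)
  have hΛ : 0 ≤ Λ := (abs_nonneg _).trans (bφ' 0)
  set D : Plane × Plane → ℝ := fun p => φ (p.1 + p.2) - φ p.1 with hD
  set U : Plane × Plane → ℝ := fun p => u (p.1 + p.2) - u p.1 with hU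
  have bD : ∀ p, |D p| ≤ 2 * Φ := fun p => by
    have := abs_sub (φ (p.1 + p.2)) (φ p.1)
    linarith [bφ (p.1 + p.2), bφ p.1]
  have bU : ∀ p, |U p| ≤ 2 * M := fun p => by
    have := abs_sub (u (p.1 + p.2)) (u p.1)
    linarith [bu (p.1 + p.2), bu p.1]
  set G : Plane × Plane → ℝ := fun p => D p ^ 2 * k p.2 with hG
  set G1 : Plane × Plane → ℝ := fun p =>
    2 * D p * φ' (p.1 + p.2) * k p.2 + D p ^ 2 * k' p.2 with hG1
  set G2 := mixedDeriv φ φ' k k' k'' with hG2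
  have hh0 : ∀ y, 0 ≤ h y := fun y => (abs_nonneg _).trans (bk y)
  have bG : ∀ p, |G p| ≤ (2 * Φ) ^ 2 * h p.2 := fun p => by
    rw [hG, abs_mul, abs_pow]
    gcongr
    exacts [bD p, bk _]
  have bG1 : ∀ p, |G1 p| ≤ (2 * (2 * Φ) * Λ + (2 * Φ) ^ 2) * h p.2 := fun p => by
    have t1 : |2 * D p * φ' (p.1 + p.2) * k p.2| ≤ 2 * (2 * Φ) * Λ * h p.2 := by
      rw [abs_mul, abs_mul, abs_mul, abs_two]
      gcongr
      exacts [bD p, bφ' _, bk _]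
    have t2 : |D p ^ 2 * k' p.2| ≤ (2 * Φ) ^ 2 * h p.2 := by
      rw [abs_mul, abs_pow]
      gcongr
      exacts [bD p, bk' _]
    refine (abs_add_le _ _).trans ?_
    linarith
  have bG2 : ∀ p, |G2 p| ≤ (2 * Λ * Λ + 2 * (2 * Φ) * Λ + 2 * (2 * Φ) * Λ + (2 * Φ) ^ 2) * h p.2 :=
    fun p => by
    have t1 : |-2 * φ' p.1 * φ' (p.1 + p.2) * k p.2| ≤ 2 * Λ * Λ * h p.2 := by
      rw [abs_mul, abs_mul, abs_mul, abs_neg, abs_two]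
      gcongr
      exacts [bφ' _, bφ' _, bk _]
    have t2 : |2 * D p * φ' (p.1 + p.2) * k' p.2| ≤ 2 * (2 * Φ) * Λ * h p.2 := by
      rw [abs_mul, abs_mul, abs_mul, abs_two]
      gcongr
      exacts [bD p, bφ' _, bk' _]
    have t3 : |2 * D p * φ' p.1 * k' p.2| ≤ 2 * (2 * Φ) * Λ * h p.2 := by
      rw [abs_mul, abs_mul, abs_mul, abs_two]
      gcongr
      exacts [bD p, bφ' _, bk' _]
    have t4 : |D p ^ 2 * k'' p.2| ≤ (2 * Φ) ^ 2 * h p.2 := by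
      rw [abs_mul, abs_pow]
      gcongr
      exacts [bD p, bk'' _]
    rw [hG2, mixedDeriv]
    have e1 := abs_sub (-2 * φ' p.1 * φ' (p.1 + p.2) * k p.2
      - 2 * D p * φ' (p.1 + p.2) * k' p.2 - 2 * D p * φ' p.1 * k' p.2) (D p ^ 2 * k'' p.2)
    have e2 := abs_sub (-2 * φ' p.1 * φ' (p.1 + p.2) * k p.2
      - 2 * D p * φ' (p.1 + p.2) * k' p.2) (2 * D p * φ' p.1 * k' p.2)
    have e3 := abs_sub (-2 * φ' p.1 * φ' (p.1 + p.2) * k p.2)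
      (2 * D p * φ' (p.1 + p.2) * k' p.2)
    simp only [hD] at *
    linarith
  have off : ∀ p, p ∉ strip r → φ p.1 = 0 ∧ φ (p.1 + p.2) = 0 ∧ φ' p.1 = 0 ∧ φ' (p.1 + p.2) = 0 :=
    fun p hp => by
    have h1 : p.1 ∉ Metric.ball (0 : Plane) r := fun h => hp (Or.inl h)
    have h2 : p.1 + p.2 ∉ Metric.ball (0 : Plane) r := fun h => hp (Or.inr h)
    exact ⟨sφ _ h1, sφ _ h2, sφ' _ h1, sφ' _ h2⟩
  have oG : ∀ p, p ∉ strip r → G p = 0 := fun p hp => by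
    obtain ⟨h1, h2, h3, h4⟩ := off p hp; simp [hG, hD, h1, h2]
  have oG1 : ∀ p, p ∉ strip r → G1 p = 0 := fun p hp => by
    obtain ⟨h1, h2, h3, h4⟩ := off p hp; simp [hG1, hD, h1, h2]
  have oG2 : ∀ p, p ∉ strip r → G2 p = 0 := fun p hp => by
    obtain ⟨h1, h2, h3, h4⟩ := off p hp; simp [hG2, mixedDeriv, h1, h2, h3]
  have cD : Continuous D := by fun_prop
  have cU : Continuous U := by fun_prop
  have cG : Continuous G := by fun_prop
  have cG1 : Continuous G1 := by fun_prop
  have cG2 : Continuous G2 := by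
    simp only [hG2]; unfold mixedDeriv; fun_prop
  have integ : ∀ (F Q : Plane × Plane → ℝ) (a b : ℝ), Continuous F → Continuous Q → 0 ≤ a → 0 ≤ b →
      (∀ p, |F p| ≤ a * h p.2) → (∀ p, |Q p| ≤ b) → (∀ p, p ∉ strip r → F p = 0) →
      Integrable (fun p => F p * Q p) (volume.prod volume) := by
    intro F Q a b cF cQ ha hb hF hQ h0
    refine integrable_of_strip_bound (cF.mul cQ).aestronglyMeasurable (hh.const_mul (a * b))
      (fun p hp => by rw [h0 p hp, zero_mul]) fun p => ?_
    rw [abs_mul]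
    calc |F p| * |Q p| ≤ a * h p.2 * b := by
          have := hh0 p.2
          gcongr
          exacts [hF p, hQ p]
      _ = _ := by ring
  have dshift : ∀ {f f' : Plane → ℝ}, (∀ x, HasLineDerivAt ℝ f (f' x) x v) → ∀ p : Plane × Plane,
      HasDerivAt (fun t : ℝ => f (p.1 + (p.2 + t • v))) (f' (p.1 + p.2)) 0 := fun hf p => by
    have := hf (p.1 + p.2)
    simpa only [HasLineDerivAt, add_assoc] using this
  -- Along (0, v) the point x is frozen, so w(x+y) is the derivative of the increment U and w(x) is
  -- a constant factor.
  have step1 : ∫ p : Plane × Plane, (G p * w p.1) * w (p.1 + p.2) ∂(volume.prod volume) =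
      -∫ p, (G1 p * w p.1) * U p ∂(volume.prod volume) := by
    refine integral_bilinear_hasLineDerivAt_right_eq_neg_left_of_integrable
      (μ := (volume : Measure Plane).prod volume) (v := ((0 : Plane), v))
      (B := ContinuousLinearMap.mul ℝ ℝ) (f := fun p => G p * w p.1) (f' := fun p => G1 p * w p.1)
      (g := U) (g' := fun p => w (p.1 + p.2)) ?_ ?_ ?_ ?_ ?_
    · have := integ G1 (fun p => w p.1 * U p) _ (B * (2 * M)) cG1 (by fun_prop) (by positivity)
        (by positivity) bG1 (fun p => by
          rw [abs_mul]
          have := bw p.1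
          have := bU p
          gcongr) oG1
      simpa only [ContinuousLinearMap.mul_apply', mul_assoc] using this
    · have := integ G (fun p => w p.1 * w (p.1 + p.2)) _ (B * B) cG (by fun_prop) (by positivity)
        (by positivity) bG (fun p => by
          rw [abs_mul]
          have := bw p.1
          have := bw (p.1 + p.2)
          gcongr) oG
      simpa only [ContinuousLinearMap.mul_apply', mul_assoc] using this
    · have := integ G (fun p => w p.1 * U p) _ (B * (2 * M)) cG (by fun_prop) (by positivity)
        (by positivity) bG (fun p => by
          rw [abs_mul]
          have := bw p.1
          have := bU p
          gcongr) oG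
      simpa only [ContinuousLinearMap.mul_apply', mul_assoc] using this
    · intro p _
      have d1 := dshift hφ p
      have d2 : HasDerivAt (fun t : ℝ => k (p.2 + t • v)) (k' p.2) 0 := hk p.2
      have := ((((d1.sub_const (φ p.1)).pow 2).mul d2).mul_const (w p.1))
      simp only [HasLineDerivAt, Prod.fst_add, Prod.snd_add, Prod.smul_mk, smul_zero, add_zero,
        hG, hD]
      refine this.congr_deriv ?_
      simp only [hG1, hD, zero_smul, add_zero, Pi.pow_apply]
      push_cast; ring
    · intro p _
      have d1 := dshift hu p
      simp only [HasLineDerivAt, Prod.fst_add, Prod.snd_add, Prod.smul_mk, smul_zero, add_zero, hU]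
      exact d1.sub_const _
  -- Along (v, −v) the sum x + y is frozen, so U has derivative −w(x) and −2Uw(x) is the derivative
  -- of U².
  have step2 : ∫ p : Plane × Plane, G1 p * (-2 * U p * w p.1) ∂(volume.prod volume) =
      -∫ p, G2 p * U p ^ 2 ∂(volume.prod volume) := by
    refine integral_bilinear_hasLineDerivAt_right_eq_neg_left_of_integrable
      (μ := (volume : Measure Plane).prod volume) (v := (v, -v))
      (B := ContinuousLinearMap.mul ℝ ℝ) (f := G1) (f' := G2)
      (g := fun p => U p ^ 2) (g' := fun p => -2 * U p * w p.1) ?_ ?_ ?_ ?_ ?_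
    · exact integ G2 (fun p => U p ^ 2) _ ((2 * M) ^ 2) cG2 (by fun_prop) (by positivity)
        (by positivity) bG2 (fun p => by
          rw [abs_pow]
          have := bU p
          gcongr) oG2
    · exact integ G1 (fun p => -2 * U p * w p.1) _ (2 * (2 * M) * B) cG1 (by fun_prop)
        (by positivity) (by positivity) bG1 (fun p => by
          rw [abs_mul, abs_mul, abs_neg, abs_two]
          have := bU p
          have := bw p.1
          gcongr) oG1
    · exact integ G1 (fun p => U p ^ 2) _ ((2 * M) ^ 2) cG1 (by fun_prop) (by positivity)
        (by positivity) bG1 (fun p => by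
          rw [abs_pow]
          have := bU p
          gcongr) oG1
    · intro p _
      have d1 : HasDerivAt (fun t : ℝ => φ (p.1 + t • v)) (φ' p.1) 0 := hφ p.1
      have d2 : HasDerivAt (fun t : ℝ => k (p.2 + t • -v)) (-k' p.2) 0 := by
        have : HasLineDerivAt ℝ k (-k' p.2) p.2 (-v) := by simpa using (hk p.2).smul (-1)
        exact this
      have d3 : HasDerivAt (fun t : ℝ => k' (p.2 + t • -v)) (-k'' p.2) 0 := by
        have : HasLineDerivAt ℝ k' (-k'' p.2) p.2 (-v) := by simpa using (hk' p.2).smul (-1)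
        exact this
      have d4 := d1.const_sub (φ (p.1 + p.2))
      have := (((d4.const_mul 2).mul_const (φ' (p.1 + p.2))).mul d2).add ((d4.pow 2).mul d3)
      have ecancel : ∀ t : ℝ, p.1 + t • v + (p.2 + t • -v) = p.1 + p.2 := fun t => by module
      simp only [HasLineDerivAt, Prod.fst_add, Prod.snd_add, Prod.smul_mk, hG1, hD, ecancel]
      refine this.congr_deriv ?_
      simp only [hG2, mixedDeriv, zero_smul, add_zero, Pi.pow_apply]
      push_cast; ring
    · intro p _
      have d1 : HasDerivAt (fun t : ℝ => u (p.1 + t • v)) (w p.1) 0 := hu p.1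
      have ecancel : ∀ t : ℝ, p.1 + t • v + (p.2 + t • -v) = p.1 + p.2 := fun t => by module
      simp only [HasLineDerivAt, Prod.fst_add, Prod.snd_add, Prod.smul_mk, hU, ecancel]
      refine ((d1.const_sub (u (p.1 + p.2))).pow 2).congr_deriv ?_
      simp only [zero_smul, add_zero]
      push_cast; ring
  have e1 : ∫ p : Plane × Plane, k p.2 * (φ (p.1 + p.2) - φ p.1) ^ 2 * (w p.1 * w (p.1 + p.2))
      ∂(volume.prod volume) =
      ∫ p : Plane × Plane, (G p * w p.1) * w (p.1 + p.2) ∂(volume.prod volume) := by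
    congr 1; funext p; simp only [hG, hD]; ring
  have e2 : ∫ p : Plane × Plane, G1 p * (-2 * U p * w p.1) ∂(volume.prod volume) =
      -2 * ∫ p, (G1 p * w p.1) * U p ∂(volume.prod volume) := by
    rw [← integral_const_mul]; congr 1; funext p; ring
  rw [e1, step1]
  rw [e2] at step2
  change _ = -(1 / 2) * ∫ p, G2 p * U p ^ 2 ∂(volume.prod volume)
  linarith

theorem cubicWeight_one (y : Plane) : cubicWeight 1 y = min (‖y‖ ^ 2) 1 / ‖y‖ ^ 3 := by
  rw [cubicWeight]; norm_num

/-- For |y| < 1 both endpoints lie in the disk of radius r + 1, where the mean value inequality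
gives L²|y|²; for |y| ≥ 1 the increment is at most 2M. -/
theorem increment_sq_le {u : Plane → ℝ} (hu : ContDiff ℝ 1 u) {M L r : ℝ} (hM : ∀ x, |u x| ≤ M)
    (hL : ∀ z ∈ Metric.ball (0 : Plane) (r + 1), ‖fderiv ℝ u z‖ ≤ L) {p : Plane × Plane}
    (hp : p ∈ strip r) :
    (u (p.1 + p.2) - u p.1) ^ 2 / ‖p.2‖ ^ 3 ≤ (L ^ 2 + 4 * M ^ 2) * cubicWeight 1 p.2 := by
  rw [cubicWeight_one, ← mul_div_assoc]
  gcongr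
  have hU : |u (p.1 + p.2) - u p.1| ≤ 2 * M := by
    have := abs_sub (u (p.1 + p.2)) (u p.1)
    linarith [hM (p.1 + p.2), hM p.1]
  rcases le_or_gt 1 ‖p.2‖ with h | h
  · rw [min_eq_right (one_le_pow₀ h), ← sq_abs]
    nlinarith [abs_nonneg (u (p.1 + p.2) - u p.1), sq_nonneg L]
  · rw [min_eq_left (pow_le_one₀ (norm_nonneg _) h.le)]
    have h1 : p.1 ∈ Metric.ball (0 : Plane) (r + 1) ∧
        p.1 + p.2 ∈ Metric.ball (0 : Plane) (r + 1) := by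
      simp only [strip, Set.mem_ofPred_eq, mem_ball_zero_iff] at hp ⊢
      rcases hp with hp | hp
      · exact ⟨by linarith, (norm_add_le _ _).trans_lt (by linarith)⟩
      · refine ⟨?_, by linarith⟩
        have := norm_sub_le (p.1 + p.2) p.2
        rw [add_sub_cancel_right] at this
        linarith
    have h2 := (convex_ball (0 : Plane) (r + 1)).norm_image_sub_le_of_norm_fderiv_le
      (fun z _ => hu.differentiable (by norm_num) z) hL h1.1 h1.2
    rw [add_sub_cancel_left, Real.norm_eq_abs] at h2
    have h3 : |u (p.1 + p.2) - u p.1| ^ 2 ≤ (L * ‖p.2‖) ^ 2 := by gcongr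
    rw [sq_abs] at h3
    nlinarith [mul_nonneg (sq_nonneg M) (sq_nonneg ‖p.2‖)]

theorem exists_fderiv_bound {u : Plane → ℝ} (hu : ContDiff ℝ 1 u) (r : ℝ) :
    ∃ L : ℝ, 0 ≤ L ∧ ∀ z ∈ Metric.ball (0 : Plane) r, ‖fderiv ℝ u z‖ ≤ L := by
  obtain ⟨L, hL⟩ := (isCompact_closedBall (0 : Plane) r).exists_bound_of_continuousOn
    (hu.continuous_fderiv (by norm_num)).continuousOn
  exact ⟨max L 0, le_max_right _ _, fun z hz =>
    (hL z (Metric.ball_subset_closedBall hz)).trans (le_max_left _ _)⟩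

theorem integrableOn_increment_sq {u : Plane → ℝ} (hu : ContDiff ℝ 1 u) {M : ℝ}
    (hM : ∀ x, |u x| ≤ M) (r : ℝ) :
    IntegrableOn (fun p : Plane × Plane => (u (p.1 + p.2) - u p.1) ^ 2 / ‖p.2‖ ^ 3) (strip r)
      (volume.prod volume) := by
  obtain ⟨L, -, hL⟩ := exists_fderiv_bound hu (r + 1)
  have := hu.continuous
  refine (integrableOn_strip ((integrable_cubicWeight one_pos).const_mul (L ^ 2 + 4 * M ^ 2))
    r).mono' (Measurable.aestronglyMeasurable ?_) ?_
  · exact (Continuous.measurable (by fun_prop)).div (by fun_prop)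
  · filter_upwards [ae_restrict_mem (measurableSet_strip r)] with p hp
    rw [Real.norm_of_nonneg (by positivity)]
    exact increment_sq_le hu hM hL hp

theorem eq_zero_of_tsupport_subset {φ : Plane → ℝ} {r : ℝ}
    (hs : tsupport φ ⊆ Metric.ball (0 : Plane) r) (x : Plane)
    (hx : x ∉ Metric.ball (0 : Plane) r) : φ x = 0 ∧ fderiv ℝ φ x = 0 :=
  ⟨image_eq_zero_of_notMem_tsupport fun h => hx (hs h), fderiv_of_notMem_tsupport (𝕜 := ℝ) fun h => hx (hs h)⟩

/-- Each derivative falling on k costs a factor |y|⁻¹, which is repaid by an undifferentiated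
increment of φ of size at most Λ|y|. The four terms contribute 2 + 2 + 2 + 1 = 7. -/
theorem abs_mixedDeriv_le {φ k : Plane → ℝ} {v : Plane} (hv : ‖v‖ = 1) (hφ : ContDiff ℝ 1 φ)
    {Λ A : ℝ} (hΛ : ∀ x, ‖fderiv ℝ φ x‖ ≤ Λ)
    (hk : ∀ y, |k y| ≤ A / ‖y‖ ^ 3 ∧ ‖fderiv ℝ k y‖ ≤ A / ‖y‖ ^ 4 ∧
        ‖fderiv ℝ (fderiv ℝ k) y‖ ≤ A / ‖y‖ ^ 5) (p : Plane × Plane) :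
    |mixedDeriv φ (fun x => fderiv ℝ φ x v) k (fun y => fderiv ℝ k y v)
      (fun y => fderiv ℝ (fderiv ℝ k) y v v) p| ≤ 7 * A * Λ ^ 2 / ‖p.2‖ ^ 3 := by
  have hΛ0 : 0 ≤ Λ := (norm_nonneg _).trans (hΛ 0)
  have bφ' : ∀ x, |fderiv ℝ φ x v| ≤ Λ := fun x => by
    have := (fderiv ℝ φ x).le_opNorm v
    rw [hv, mul_one, Real.norm_eq_abs] at this
    exact this.trans (hΛ x)
  have bk' : ∀ y, |fderiv ℝ k y v| ≤ A / ‖y‖ ^ 4 := fun y => by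
    have := (fderiv ℝ k y).le_opNorm v
    rw [hv, mul_one, Real.norm_eq_abs] at this
    exact this.trans (hk y).2.1
  have bk'' : ∀ y, |fderiv ℝ (fderiv ℝ k) y v v| ≤ A / ‖y‖ ^ 5 := fun y => by
    have h1 := (fderiv ℝ (fderiv ℝ k) y v).le_opNorm v
    have h2 := (fderiv ℝ (fderiv ℝ k) y).le_opNorm v
    rw [hv, mul_one] at h1 h2
    rw [Real.norm_eq_abs] at h1
    exact (h1.trans h2).trans (hk y).2.2
  have bD : |φ (p.1 + p.2) - φ p.1| ≤ Λ * ‖p.2‖ := by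
    have := convex_univ.norm_image_sub_le_of_norm_fderiv_le (𝕜 := ℝ) (f := φ) (x := p.1)
      (y := p.1 + p.2) (fun z _ => hφ.differentiable (by norm_num) z) (fun z _ => hΛ z)
      trivial trivial
    simpa using this
  -- At the origin `A / 0 = 0`, so the hypothesis forces k to vanish there.
  rcases eq_or_ne p.2 0 with h0 | h0
  · have k0 : |k p.2| ≤ 0 := by simpa [h0] using (hk p.2).1
    have k1 : k p.2 = 0 := abs_eq_zero.1 (le_antisymm k0 (abs_nonneg _))
    have D0 : φ (p.1 + p.2) - φ p.1 = 0 := by simp [h0]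
    rw [mixedDeriv, k1, D0, h0]
    simp
  have hr : 0 < ‖p.2‖ := norm_pos_iff.2 h0
  set a := fderiv ℝ φ p.1 v
  set b := fderiv ℝ φ (p.1 + p.2) v
  set D := φ (p.1 + p.2) - φ p.1
  set ρ := ‖p.2‖
  have ha : |a| ≤ Λ := bφ' _
  have hb : |b| ≤ Λ := bφ' _
  have t1 : |-2 * a * b * k p.2| ≤ 2 * Λ * Λ * (A / ρ ^ 3) := by
    rw [abs_mul, abs_mul, abs_mul, abs_neg, abs_two]
    gcongr
    exact (hk p.2).1
  have t2 : |2 * D * b * fderiv ℝ k p.2 v| ≤ 2 * (Λ * ρ) * Λ * (A / ρ ^ 4) := by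
    rw [abs_mul, abs_mul, abs_mul, abs_two]
    gcongr
    exact bk' p.2
  have t3 : |2 * D * a * fderiv ℝ k p.2 v| ≤ 2 * (Λ * ρ) * Λ * (A / ρ ^ 4) := by
    rw [abs_mul, abs_mul, abs_mul, abs_two]
    gcongr
    exact bk' p.2
  have t4 : |D ^ 2 * fderiv ℝ (fderiv ℝ k) p.2 v v| ≤ (Λ * ρ) ^ 2 * (A / ρ ^ 5) := by
    rw [abs_mul, abs_pow]
    gcongr
    exact bk'' p.2
  have e : 2 * Λ * Λ * (A / ρ ^ 3) + 2 * (Λ * ρ) * Λ * (A / ρ ^ 4) + 2 * (Λ * ρ) * Λ * (A / ρ ^ 4)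
      + (Λ * ρ) ^ 2 * (A / ρ ^ 5) = 7 * A * Λ ^ 2 / ρ ^ 3 := by
    field_simp; ring
  rw [mixedDeriv]
  have e1 := abs_sub (-2 * a * b * k p.2 - 2 * D * b * fderiv ℝ k p.2 v -
    2 * D * a * fderiv ℝ k p.2 v) (D ^ 2 * fderiv ℝ (fderiv ℝ k) p.2 v v)
  have e2 := abs_sub (-2 * a * b * k p.2 - 2 * D * b * fderiv ℝ k p.2 v)
    (2 * D * a * fderiv ℝ k p.2 v)
  have e3 := abs_sub (-2 * a * b * k p.2) (2 * D * b * fderiv ℝ k p.2 v)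
  change |-2 * a * b * k p.2 - 2 * D * b * fderiv ℝ k p.2 v -
    2 * D * a * fderiv ℝ k p.2 v - D ^ 2 * fderiv ℝ (fderiv ℝ k) p.2 v v| ≤ _
  linarith

set_option maxSynthPendingDepth 3 in
/-- A truncated kernel and its derivatives are dominated by the integrable weight. -/
theorem exists_weight_bound {k : Plane → ℝ} {A τ : ℝ} (hA : 0 ≤ A) (hτ : 0 < τ)
    (h0 : ∀ y, ‖y‖ < τ → k y = 0)
    (hk : ∀ y, |k y| ≤ A / ‖y‖ ^ 3 ∧ ‖fderiv ℝ k y‖ ≤ A / ‖y‖ ^ 4 ∧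
        ‖fderiv ℝ (fderiv ℝ k) y‖ ≤ A / ‖y‖ ^ 5) :
    ∃ H : ℝ, 0 ≤ H ∧ ∀ y, |k y| ≤ H * cubicWeight 1 y ∧
      ‖fderiv ℝ k y‖ ≤ H * cubicWeight 1 y ∧
      ‖fderiv ℝ (fderiv ℝ k) y‖ ≤ H * cubicWeight 1 y := by
  -- Where k does not vanish, |y| ≥ τ. The first bracket absorbs the surplus powers |y|⁻¹ and |y|⁻²
  -- of the derivative bounds; the second compensates for min(|y|², 1).
  refine ⟨A * (1 + τ⁻¹ + τ⁻¹ ^ 2) * (1 + τ⁻¹ ^ 2), by positivity, fun y => ?_⟩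
  have hw := cubicWeight_nonneg 1 y
  rcases lt_or_ge ‖y‖ τ with hy | hy
  · have near : k =ᶠ[𝓝 y] fun _ => (0 : ℝ) := by
      filter_upwards [(isOpen_lt continuous_norm continuous_const).mem_nhds hy] with z hz
      exact h0 z hz
    have near' : fderiv ℝ k =ᶠ[𝓝 y] fun _ => 0 := by
      filter_upwards [near.fderiv (𝕜 := ℝ)] with z hz
      simpa using hz
    have z2 : fderiv ℝ (fderiv ℝ k) y = 0 := by rw [near'.fderiv_eq]; simp
    rw [near.eq_of_nhds, near'.eq_of_nhds, z2]
    simp only [abs_zero, norm_zero]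
    have : 0 ≤ A * (1 + τ⁻¹ + τ⁻¹ ^ 2) * (1 + τ⁻¹ ^ 2) * cubicWeight 1 y := by positivity
    exact ⟨this, this, this⟩
  have hr : 0 < ‖y‖ := hτ.trans_le hy
  have hmin : 1 ≤ (1 + τ⁻¹ ^ 2) * min (‖y‖ ^ 2) 1 := by
    rcases le_total (‖y‖ ^ 2) 1 with h | h
    · rw [min_eq_left h]
      have : τ⁻¹ ^ 2 * τ ^ 2 ≤ τ⁻¹ ^ 2 * ‖y‖ ^ 2 := by gcongr
      rw [← mul_pow, inv_mul_cancel₀ hτ.ne', one_pow] at this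
      nlinarith [sq_nonneg ‖y‖]
    · rw [min_eq_right h]; nlinarith [sq_nonneg τ⁻¹]
  have hinv : ‖y‖⁻¹ ≤ τ⁻¹ := inv_anti₀ hτ hy
  have key : ∀ c : ℝ, 0 ≤ c → c ≤ 1 + τ⁻¹ + τ⁻¹ ^ 2 →
      A * c / ‖y‖ ^ 3 ≤ A * (1 + τ⁻¹ + τ⁻¹ ^ 2) * (1 + τ⁻¹ ^ 2) * cubicWeight 1 y := fun c hc0 hc => by
    rw [cubicWeight_one, ← mul_div_assoc]
    refine div_le_div_of_nonneg_right ?_ (by positivity)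
    calc A * c ≤ A * (1 + τ⁻¹ + τ⁻¹ ^ 2) * 1 := by rw [mul_one]; gcongr
      _ ≤ A * (1 + τ⁻¹ + τ⁻¹ ^ 2) * ((1 + τ⁻¹ ^ 2) * min (‖y‖ ^ 2) 1) := by gcongr
      _ = _ := by ring
  have hτi : 0 < τ⁻¹ := by positivity
  have hsq : ‖y‖⁻¹ ^ 2 ≤ τ⁻¹ ^ 2 := by gcongr
  refine ⟨(hk y).1.trans ?_, (hk y).2.1.trans ?_, (hk y).2.2.trans ?_⟩
  · simpa using key 1 zero_le_one (by nlinarith)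
  · refine le_trans (le_of_eq ?_) (key ‖y‖⁻¹ (by positivity) (by nlinarith))
    field_simp
  · refine le_trans (le_of_eq ?_) (key (‖y‖⁻¹ ^ 2) (by positivity) (by nlinarith))
    field_simp

/-- The squared increment of φ is O(|y|²) near the diagonal, which tames |y|⁻³. The dominating
function is independent of k, so it also serves for removing the truncation of the kernel. -/
theorem integrable_increment_sq_mul {φ k g : Plane → ℝ} {A Λ r B : ℝ} {q : Plane × Plane → ℝ}
    (hφ : ContDiff ℝ 1 φ) (hφ1 : ∀ x, |φ x| ≤ 1)
    (hs : tsupport φ ⊆ Metric.ball (0 : Plane) r) (hΛ : ∀ x, ‖fderiv ℝ φ x‖ ≤ Λ)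
    (hkm : Measurable k) (hg : ∀ y, |k y| ≤ g y) (hgA : ∀ y, g y ≤ A / ‖y‖ ^ 3)
    (hq : Measurable q) (hB : ∀ p, |q p| ≤ B) :
    Integrable (fun p : Plane × Plane => k p.2 * (φ (p.1 + p.2) - φ p.1) ^ 2 * q p)
        (volume.prod volume) ∧
      Integrable (fun p : Plane × Plane => A * B / ‖p.2‖ ^ 3 * (φ (p.1 + p.2) - φ p.1) ^ 2)
        (volume.prod volume) ∧
      ∀ p, |k p.2 * (φ (p.1 + p.2) - φ p.1) ^ 2 * q p| ≤
        A * B / ‖p.2‖ ^ 3 * (φ (p.1 + p.2) - φ p.1) ^ 2 := by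
  have hB0 : 0 ≤ B := (abs_nonneg _).trans (hB 0)
  have hφc := hφ.continuous
  have off : ∀ p, p ∉ strip r → φ (p.1 + p.2) - φ p.1 = 0 := fun p hp => by
    rw [(eq_zero_of_tsupport_subset hs _ fun h => hp (Or.inl h)).1,
      (eq_zero_of_tsupport_subset hs _ fun h => hp (Or.inr h)).1, sub_zero]
  have hpt : ∀ p : Plane × Plane, |k p.2 * (φ (p.1 + p.2) - φ p.1) ^ 2 * q p| ≤
      A * B / ‖p.2‖ ^ 3 * (φ (p.1 + p.2) - φ p.1) ^ 2 := fun p => by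
    rw [abs_mul, abs_mul, abs_pow, sq_abs]
    have h1 := (hg p.2).trans (hgA p.2)
    have h2 := hB p
    calc |k p.2| * (φ (p.1 + p.2) - φ p.1) ^ 2 * |q p|
        ≤ A / ‖p.2‖ ^ 3 * (φ (p.1 + p.2) - φ p.1) ^ 2 * B := by
          gcongr
          exact mul_nonneg ((abs_nonneg _).trans h1) (sq_nonneg _)
      _ = _ := by ring
  have hint : Integrable (fun p : Plane × Plane =>
      A * B / ‖p.2‖ ^ 3 * (φ (p.1 + p.2) - φ p.1) ^ 2) (volume.prod volume) := by
    refine integrable_of_strip_bound (r := r)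
      (h := fun y => |A * B| * ((Λ ^ 2 + 4 * 1 ^ 2) * cubicWeight 1 y)) ?_
      (((integrable_cubicWeight one_pos).const_mul _).const_mul _) (fun p hp => ?_) fun p => ?_
    · refine Measurable.aestronglyMeasurable (Measurable.mul ?_ ?_)
      · exact measurable_const.div (by fun_prop)
      · exact Continuous.measurable (by fun_prop)
    · rw [off p hp]; simp
    · by_cases hp : p ∈ strip r
      · rw [show A * B / ‖p.2‖ ^ 3 * (φ (p.1 + p.2) - φ p.1) ^ 2 =
          A * B * ((φ (p.1 + p.2) - φ p.1) ^ 2 / ‖p.2‖ ^ 3) by ring, abs_mul]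
        gcongr
        rw [abs_of_nonneg (by positivity)]
        exact increment_sq_le hφ hφ1 (fun z _ => hΛ z) hp
      · rw [off p hp]
        have := cubicWeight_nonneg 1 p.2
        simp only [ne_eq, OfNat.ofNat_ne_zero, not_false_eq_true, zero_pow, mul_zero, abs_zero]
        positivity
  refine ⟨hint.mono' (Measurable.aestronglyMeasurable ?_) (Eventually.of_forall hpt), hint, hpt⟩
  exact ((hkm.comp measurable_snd).mul (Continuous.measurable (by fun_prop))).mul hq

/-- Two integrations by parts bound the quadratic form of a directional derivative by the
energy. -/
theorem exists_quadratic_increment_le {β : ℝ} (h1 : 2 / 3 < β) (h2 : β < 3 / 2) :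
    ∃ C : ℝ, 0 ≤ C ∧ ∀ (u φ : Plane → ℝ) (v : Plane) (M B r Λ : ℝ), ContDiff ℝ 1 u →
      (∀ x, |u x| ≤ M) → ‖v‖ = 1 → (∀ x, |fderiv ℝ u x v| ≤ B) → ContDiff ℝ 1 φ →
      (∀ x, |φ x| ≤ 1) → tsupport φ ⊆ Metric.ball (0 : Plane) r → (∀ x, ‖fderiv ℝ φ x‖ ≤ Λ) →
      ∫ p : Plane × Plane, kernel β p.2 * (φ (p.1 + p.2) - φ p.1) ^ 2 *
          (fderiv ℝ u p.1 v * fderiv ℝ u (p.1 + p.2) v) ∂(volume.prod volume) ≤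
        C * Λ ^ 2 * ∫ p in strip r, (u (p.1 + p.2) - u p.1) ^ 2 / ‖p.2‖ ^ 3
          ∂(volume.prod volume) := by
  have hβ : 0 < β := by linarith
  obtain ⟨A, hA, hk⟩ := exists_truncated_kernel h1 h2
  obtain ⟨A', hA', hK⟩ := exists_kernel_le hβ
  refine ⟨7 * A / 2, by positivity, fun u φ v M B r Λ hu hM hv hB hφ hφ1 hs hΛ => ?_⟩
  have hB0 : 0 ≤ B := (abs_nonneg _).trans (hB 0)
  have cw : Continuous fun x => fderiv ℝ u x v :=
    (hu.continuous_fderiv (by norm_num)).clm_apply continuous_const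
  have cφ' : Continuous fun x => fderiv ℝ φ x v :=
    (hφ.continuous_fderiv (by norm_num)).clm_apply continuous_const
  have line : ∀ {f : Plane → ℝ}, ContDiff ℝ 1 f → ∀ x, HasLineDerivAt ℝ f (fderiv ℝ f x v) x v :=
    fun hf x => (hf.differentiable (by norm_num) x).hasFDerivAt.hasLineDerivAt v
  choose! k hk using hk
  set τ : ℕ → ℝ := fun n => 1 / ((n : ℝ) + 1) with hτ
  have hτ0 : ∀ n, 0 < τ n := fun n => by positivity
  have hτlim : Tendsto τ atTop (𝓝 0) := tendsto_one_div_add_atTop_nhds_zero_nat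
  have hq : Measurable fun p : Plane × Plane => fderiv ℝ u p.1 v * fderiv ℝ u (p.1 + p.2) v :=
    Continuous.measurable
      ((cw.comp continuous_fst).mul (cw.comp (continuous_fst.add continuous_snd)))
  have hqB : ∀ p : Plane × Plane, |fderiv ℝ u p.1 v * fderiv ℝ u (p.1 + p.2) v| ≤ B * B :=
    fun p => by
      rw [abs_mul]
      have := hB p.1
      have := hB (p.1 + p.2)
      gcongr
  have hfinal : ∀ n, ∫ p : Plane × Plane, k (τ n) p.2 * (φ (p.1 + p.2) - φ p.1) ^ 2 *
          (fderiv ℝ u p.1 v * fderiv ℝ u (p.1 + p.2) v) ∂(volume.prod volume) ≤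
        7 * A / 2 * Λ ^ 2 * ∫ p in strip r, (u (p.1 + p.2) - u p.1) ^ 2 / ‖p.2‖ ^ 3
          ∂(volume.prod volume) := fun n => by
    obtain ⟨kd, -, -, k0, kb⟩ := hk (τ n) (hτ0 n)
    obtain ⟨H, hH, kw⟩ := exists_weight_bound hA (hτ0 n) k0 kb
    have kd1 : ContDiff ℝ 1 (fderiv ℝ (k (τ n))) := kd.fderiv_right (by norm_num)
    have kd1v : ContDiff ℝ 1 fun y => fderiv ℝ (k (τ n)) y v := kd1.clm_apply contDiff_const
    have b1 : ∀ y, |fderiv ℝ (k (τ n)) y v| ≤ H * cubicWeight 1 y := fun y => by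
      have := (fderiv ℝ (k (τ n)) y).le_opNorm v
      rw [hv, mul_one, Real.norm_eq_abs] at this
      exact this.trans (kw y).2.1
    have b2 : ∀ y, |fderiv ℝ (fderiv ℝ (k (τ n))) y v v| ≤ H * cubicWeight 1 y := fun y => by
      have e1 := (fderiv ℝ (fderiv ℝ (k (τ n))) y v).le_opNorm v
      have e2 := (fderiv ℝ (fderiv ℝ (k (τ n))) y).le_opNorm v
      rw [hv, mul_one] at e1 e2
      rw [Real.norm_eq_abs] at e1
      exact (e1.trans e2).trans (kw y).2.2
    have line2 : ∀ y, HasLineDerivAt ℝ (fun y => fderiv ℝ (k (τ n)) y v)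
        (fderiv ℝ (fderiv ℝ (k (τ n))) y v v) y v := fun y => by
      have e := (kd1.differentiable (by norm_num) y).hasFDerivAt.clm_apply
        (hasFDerivAt_const v y)
      have := e.hasLineDerivAt v
      simpa using this
    have bφ' : ∀ x, |fderiv ℝ φ x v| ≤ Λ := fun x => by
      have := (fderiv ℝ φ x).le_opNorm v
      rw [hv, mul_one, Real.norm_eq_abs] at this
      exact this.trans (hΛ x)
    have ck'' : Continuous fun y => fderiv ℝ (fderiv ℝ (k (τ n))) y v v :=
      ((kd1.continuous_fderiv (by norm_num)).clm_apply continuous_const).clm_apply continuous_const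
    have ibp := integral_increment_by_parts (line hu) (line hφ) (line (kd.of_le (by norm_num)))
      line2 hu.continuous cw hφ.continuous cφ' kd.continuous kd1v.continuous ck'' hM hB hφ1 bφ'
      ((integrable_cubicWeight one_pos).const_mul H) (fun y => (kw y).1) b1 b2
      (fun x hx => (eq_zero_of_tsupport_subset hs x hx).1)
      (fun x hx => by rw [(eq_zero_of_tsupport_subset hs x hx).2]; rfl)
    rw [ibp]
    set m := mixedDeriv φ (fun x => fderiv ℝ φ x v) (k (τ n)) (fun y => fderiv ℝ (k (τ n)) y v)
      (fun y => fderiv ℝ (fderiv ℝ (k (τ n))) y v v) with hm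
    have hbd := abs_mixedDeriv_le hv hφ hΛ kb
    have m0 : ∀ p, p ∉ strip r → m p = 0 := fun p hp => by
      obtain ⟨a1, a2⟩ := eq_zero_of_tsupport_subset hs p.1 fun h => hp (Or.inl h)
      obtain ⟨a3, a4⟩ := eq_zero_of_tsupport_subset hs (p.1 + p.2) fun h => hp (Or.inr h)
      simp [hm, mixedDeriv, a1, a2, a3]
    have hI := integrableOn_increment_sq hu hM r
    rw [← setIntegral_eq_integral_of_forall_compl_eq_zero (s := strip r)
      (fun p hp => by rw [m0 p hp, zero_mul]), ← integral_const_mul, ← integral_const_mul]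
    refine (Real.le_norm_self _).trans (norm_integral_le_of_norm_le (Integrable.const_mul hI _)
      (Eventually.of_forall fun p => ?_))
    rw [Real.norm_eq_abs, abs_mul, abs_mul, abs_neg, abs_of_pos (by norm_num : (0 : ℝ) < 1 / 2),
      abs_of_nonneg (sq_nonneg (u (p.1 + p.2) - u p.1))]
    calc 1 / 2 * (|m p| * (u (p.1 + p.2) - u p.1) ^ 2)
        ≤ 1 / 2 * (7 * A * Λ ^ 2 / ‖p.2‖ ^ 3 * (u (p.1 + p.2) - u p.1) ^ 2) := by
          gcongr
          exact hbd p
      _ = _ := by ring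
  -- Removal of the truncation: for fixed y ≠ 0 the truncated kernel equals K once 2τ ≤ |y|, and for
  -- y = 0 the increment of φ vanishes.
  have hlim : Tendsto (fun n => ∫ p : Plane × Plane, k (τ n) p.2 * (φ (p.1 + p.2) - φ p.1) ^ 2 *
          (fderiv ℝ u p.1 v * fderiv ℝ u (p.1 + p.2) v) ∂(volume.prod volume)) atTop
      (𝓝 (∫ p : Plane × Plane, kernel β p.2 * (φ (p.1 + p.2) - φ p.1) ^ 2 *
          (fderiv ℝ u p.1 v * fderiv ℝ u (p.1 + p.2) v) ∂(volume.prod volume))) := by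
    have hkint := fun n => integrable_increment_sq_mul (k := k (τ n)) (g := kernel β) (A := A')
      hφ hφ1 hs hΛ
      (hk (τ n) (hτ0 n)).1.continuous.measurable
      (fun y => by
        obtain ⟨-, hb, -⟩ := hk (τ n) (hτ0 n)
        rw [abs_of_nonneg (hb y).1]; exact (hb y).2)
      (fun y => (le_abs_self _).trans (hK y)) hq hqB
    refine tendsto_integral_of_dominated_convergence _ (fun n => (hkint n).1.aestronglyMeasurable)
      (hkint 0).2.1 (fun n => Eventually.of_forall (hkint n).2.2) (Eventually.of_forall fun p => ?_)
    rcases eq_or_ne p.2 0 with h0 | h0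
    · simp [h0]
    refine tendsto_const_nhds.congr' ?_
    have hpos : 0 < ‖p.2‖ / 2 := by have := norm_pos_iff.2 h0; positivity
    filter_upwards [hτlim.eventually_lt_const hpos] with n hn
    rw [(hk (τ n) (hτ0 n)).2.2.1 p.2 (by linarith)]
  exact le_of_tendsto' hlim hfinal

/-! ### Stability tested with a regularised absolute value. -/

/-- This converts the double integral over pairs (x, x+y) into the squares that appear in the
product estimate. -/
theorem integrable_mul_shift {f : Plane → ℝ} (hf : Integrable f) :
    Integrable (fun p : Plane × Plane => f p.1 * f (p.1 + p.2)) (volume.prod volume) ∧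
      ∫ y, ∫ x, f x * f (x + y) = (∫ x, f x) ^ 2 := by
  have hmp := measurePreserving_prod_add (volume : Measure Plane) (volume : Measure Plane)
  have hemb : MeasurableEmbedding fun z : Plane × Plane => (z.1, z.1 + z.2) :=
    (Homeomorph.measurableEmbedding
      ⟨⟨fun z : Plane × Plane => (z.1, z.1 + z.2), fun z => (z.1, z.2 - z.1),
        fun z => by simp, fun z => by simp⟩, by fun_prop, by fun_prop⟩)
  have hff : Integrable (fun p : Plane × Plane => f p.1 * f p.2) (volume.prod volume) :=
    hf.mul_prod hf
  have hi : Integrable (fun p : Plane × Plane => f p.1 * f (p.1 + p.2)) (volume.prod volume) :=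
    hmp.integrable_comp_of_integrable hff
  refine ⟨hi, ?_⟩
  rw [← integral_prod_symm _ hi,
    hmp.integral_comp hemb (fun p : Plane × Plane => f p.1 * f p.2), integral_prod_mul, sq]

/-- Cauchy–Schwarz for the vectors (|a|, √s) and (|b|, √s). -/
theorem abs_mul_abs_add_le_sqrt_mul_sqrt {s : ℝ} (hs : 0 ≤ s) (a b : ℝ) :
    |a| * |b| + s ≤ √(a ^ 2 + s) * √(b ^ 2 + s) := by
  rw [← Real.sqrt_mul (by positivity)]
  refine Real.le_sqrt_of_sq_le ?_
  rw [← sq_abs a, ← sq_abs b]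
  nlinarith [mul_nonneg hs (sq_nonneg (|a| - |b|))]

theorem integral_add_add_sub {f g h k : Plane → ℝ} (hf : Integrable f) (hg : Integrable g)
    (hh : Integrable h) (hk : Integrable k) :
    ∫ x, (f x + g x + h x - k x) = (∫ x, f x) + (∫ x, g x) + (∫ x, h x) - ∫ x, k x := by
  have h1 : Integrable fun x => f x + g x := hf.add hg
  have h2 : Integrable fun x => f x + g x + h x := h1.add hh
  rw [integral_sub h2 hk, integral_add h1 hh, integral_add hf hg]

/-- The identity holds pointwise, using only (√(w² + s))² = w² + s. It compares the stability test
function with the test function φ²w of the linearised equation; when φ ≥ 0 the last integrand is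
nonnegative by `abs_mul_abs_add_le_sqrt_mul_sqrt` and carries the estimate. -/
theorem incrementForm_regularized {φ w : Plane → ℝ} (cφ : Continuous φ) (hφ : HasCompactSupport φ)
    (cw : Continuous w) {s : ℝ} (hs : 0 ≤ s) (y : Plane) :
    incrementForm (fun x => φ x * √(w x ^ 2 + s)) (fun x => φ x * √(w x ^ 2 + s)) y =
      incrementForm w (fun x => φ x ^ 2 * w x) y +
        (∫ x, (φ (x + y) - φ x) ^ 2 * (w x * w (x + y))) + s * incrementForm φ φ y -
        2 * ∫ x, φ x * φ (x + y) * (√(w x ^ 2 + s) * √(w (x + y) ^ 2 + s) - w x * w (x + y) - s)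
    := by
  have hφy := hasCompactSupport_comp_add_right hφ y
  have cφy : Continuous fun x => φ (x + y) := by fun_prop
  have i1 : Integrable fun x => (w (x + y) - w x) * (φ (x + y) ^ 2 * w (x + y) - φ x ^ 2 * w x) := by
    have a1 : Integrable fun x => ((w (x + y) - w x) * φ (x + y) * w (x + y)) * φ (x + y) :=
      integrable_mul_of_hasCompactSupport (by fun_prop) cφy hφy
    have a2 : Integrable fun x => ((w (x + y) - w x) * φ x * w x) * φ x :=
      integrable_mul_of_hasCompactSupport (by fun_prop) cφ hφ
    refine (a1.sub a2).congr (Eventually.of_forall fun x => ?_)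
    simp only [Pi.sub_apply]; ring
  have i2 : Integrable fun x => (φ (x + y) - φ x) ^ 2 * (w x * w (x + y)) := by
    have a1 : Integrable fun x => ((φ (x + y) - φ x) * (w x * w (x + y))) * φ (x + y) :=
      integrable_mul_of_hasCompactSupport (by fun_prop) cφy hφy
    have a2 : Integrable fun x => ((φ (x + y) - φ x) * (w x * w (x + y))) * φ x :=
      integrable_mul_of_hasCompactSupport (by fun_prop) cφ hφ
    refine (a1.sub a2).congr (Eventually.of_forall fun x => ?_)
    simp only [Pi.sub_apply]; ring
  have i3 : Integrable fun x => (φ (x + y) - φ x) * (φ (x + y) - φ x) := by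
    have a1 : Integrable fun x => (φ (x + y) - φ x) * φ (x + y) :=
      integrable_mul_of_hasCompactSupport (by fun_prop) cφy hφy
    have a2 : Integrable fun x => (φ (x + y) - φ x) * φ x :=
      integrable_mul_of_hasCompactSupport (by fun_prop) cφ hφ
    refine (a1.sub a2).congr (Eventually.of_forall fun x => ?_)
    simp only [Pi.sub_apply]; ring
  have i4 : Integrable fun x =>
      φ x * φ (x + y) * (√(w x ^ 2 + s) * √(w (x + y) ^ 2 + s) - w x * w (x + y) - s) := by
    have a1 : Integrable fun x => (φ (x + y) *
        (√(w x ^ 2 + s) * √(w (x + y) ^ 2 + s) - w x * w (x + y) - s)) * φ x :=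
      integrable_mul_of_hasCompactSupport (by fun_prop) cφ hφ
    refine a1.congr (Eventually.of_forall fun x => ?_)
    simp only; ring
  simp only [incrementForm]
  rw [← integral_const_mul, ← integral_const_mul,
    ← integral_add_add_sub i1 i2 (i3.const_mul s) (i4.const_mul 2)]
  congr 1; funext x
  have e1 : √(w x ^ 2 + s) ^ 2 = w x ^ 2 + s := Real.sq_sqrt (by positivity)
  have e2 : √(w (x + y) ^ 2 + s) ^ 2 = w (x + y) ^ 2 + s := Real.sq_sqrt (by positivity)
  linear_combination φ x ^ 2 * e1 + φ (x + y) ^ 2 * e2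

theorem nonlocalOp_eq (β : ℝ) (η : Plane → ℝ) (x : Plane) :
    nonlocalOp β η x = -(1 / (4 * Real.pi)) * ∫ y, secondDiff η x y * kernel β y := rfl

theorem nonlocalOp_pairing {β : ℝ} (hβ : 0 < β) {η ζ : Plane → ℝ} (hη : IsLocC1Holder η) {M : ℝ}
    (hM : ∀ x, |η x| ≤ M) (hζc : Continuous ζ) (hζ : HasCompactSupport ζ) :
    Integrable (fun x => nonlocalOp β η x * ζ x) ∧
      Integrable (fun y => kernel β y * incrementForm η ζ y) ∧
      ∫ x, nonlocalOp β η x * ζ x =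
        1 / (4 * Real.pi) * ∫ y, kernel β y * incrementForm η ζ y := by
  obtain ⟨A, -, hA⟩ := exists_kernel_le hβ
  obtain ⟨h1, h2, h3⟩ := weak_form (measurable_kernel hβ) hA hη hM hζc hζ
  simp only [nonlocalOp_eq, mul_assoc]
  refine ⟨h1.const_mul _, h2, ?_⟩
  rw [integral_const_mul, h3]
  ring

/-- Testing stability with `φ √(w² + s)` and letting `s → 0`. -/
theorem exists_stability_product_bound {β : ℝ} (h1 : 2 / 3 < β) (h2 : β < 3 / 2) :
    ∃ c : ℝ, 0 < c ∧ ∀ (V w φ θ : Plane → ℝ) (B : ℝ), Continuous V →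
      (∀ η : Plane → ℝ, ContDiff ℝ 2 η → HasCompactSupport η →
        0 ≤ ∫ x, (nonlocalOp β η x + V x * η x) * η x) →
      ContDiff ℝ 2 w → (∀ x, |w x| ≤ B) → ContDiff ℝ 2 φ → HasCompactSupport φ →
      (∀ x, 0 ≤ φ x ∧ φ x ≤ 1) → Measurable θ → (∀ x, 0 ≤ θ x ∧ θ x ≤ φ x) →
      (∀ x, x ∉ Metric.ball (0 : Plane) 1 → θ x = 0) →
      c * ((∫ x, θ x * |w x|) ^ 2 - (∫ x, θ x * w x) ^ 2) ≤
        (∫ x, (nonlocalOp β w x + V x * w x) * (φ x ^ 2 * w x)) +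
        1 / (4 * Real.pi) * ∫ p : Plane × Plane, kernel β p.2 * (φ (p.1 + p.2) - φ p.1) ^ 2 *
          (w p.1 * w (p.1 + p.2)) ∂(volume.prod volume) := by
  have hβ : 0 < β := by linarith
  obtain ⟨c, hc, hcK⟩ := exists_le_kernel h1 h2
  obtain ⟨A, hA, hKA⟩ := exists_kernel_le hβ
  have hπ := Real.pi_pos
  -- The 2 is the coefficient of the gap term in `incrementForm_regularized`, 1/(4π) comes from the
  -- operator, and c/8 bounds K from below on 0 < |y| < 2.
  refine ⟨2 * (1 / (4 * Real.pi)) * (c / 8), by positivity, ?_⟩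
  intro V w φ θ B cV hst hw hB hφ hφs hφ1 hθm hθ hθ0
  have cφ := hφ.continuous
  have cw := hw.continuous
  have hφB : ∀ x, |φ x| ≤ 1 := fun x => by rw [abs_of_nonneg (hφ1 x).1]; exact (hφ1 x).2
  have hφ2 : HasCompactSupport fun x => φ x ^ 2 * w x := by
    have : (fun x => φ x ^ 2 * w x) = φ * fun x => φ x * w x := by
      funext x; simp only [Pi.mul_apply]; ring
    rw [this]; exact hφs.mul_right
  obtain ⟨iw, iKw, ew⟩ := nonlocalOp_pairing hβ (isLocC1Holder_of_contDiff hw) hB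
    (ζ := fun x => φ x ^ 2 * w x) (by fun_prop) hφ2
  obtain ⟨-, iKφ, -⟩ := nonlocalOp_pairing hβ (isLocC1Holder_of_contDiff hφ) hφB cφ hφs
  obtain ⟨r, hr⟩ := hφs.isCompact.isBounded.subset_ball 0
  obtain ⟨Λ, hΛ⟩ : ∃ Λ, ∀ x, ‖fderiv ℝ φ x‖ ≤ Λ :=
    (hφ.continuous_fderiv (by norm_num)).bounded_above_of_compact_support (hφs.fderiv (𝕜 := ℝ))
  have iP := (integrable_increment_sq_mul (k := kernel β) (g := fun y => |kernel β y|)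
    (q := fun p => w p.1 * w (p.1 + p.2)) (hφ.of_le (by norm_num)) hφB hr hΛ
    (measurable_kernel hβ) (fun y => le_rfl) hKA (Continuous.measurable (by fun_prop))
    (B := B * B) (fun p => by
      have := hB p.1
      have := hB (p.1 + p.2)
      rw [abs_mul]
      have hB0 : 0 ≤ B := (abs_nonneg _).trans (hB 0)
      gcongr)).1
  have eP : ∀ y, ∫ x, kernel β y * (φ (x + y) - φ x) ^ 2 * (w x * w (x + y)) =
      kernel β y * ∫ x, (φ (x + y) - φ x) ^ 2 * (w x * w (x + y)) := fun y => by
    rw [← integral_const_mul]; congr 1; funext x; ring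
  have iPy := iP.integral_prod_right
  rw [integral_prod_symm _ iP]
  simp only [eP] at iPy ⊢
  have iVw : Integrable fun x => V x * w x * (φ x ^ 2 * w x) :=
    integrable_mul_of_hasCompactSupport (by fun_prop) (by fun_prop) hφ2
  have iVφ : Integrable fun x => V x * φ x * φ x :=
    integrable_mul_of_hasCompactSupport (by fun_prop) cφ hφs
  have θint : Integrable θ := by
    refine (cφ.integrable_of_hasCompactSupport hφs).mono' hθm.aestronglyMeasurable
      (Eventually.of_forall fun x => ?_)
    rw [Real.norm_of_nonneg (hθ x).1]; exact (hθ x).2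
  have θw : Integrable fun x => θ x * w x :=
    θint.mul_bdd (c := B) cw.aestronglyMeasurable (Eventually.of_forall hB)
  have θaw : Integrable fun x => θ x * |w x| :=
    θint.mul_bdd (c := B) cw.abs.aestronglyMeasurable
      (Eventually.of_forall fun x => by simpa using hB x)
  obtain ⟨iA, eA⟩ := integrable_mul_shift θaw
  obtain ⟨iW, eW⟩ := integrable_mul_shift θw
  -- The estimate for the test function φ√(w² + s), with an error linear in s whose coefficient does
  -- not depend on s.
  have main : ∀ s : ℝ, 0 < s →
      2 * (1 / (4 * Real.pi)) * (c / 8) * ((∫ x, θ x * |w x|) ^ 2 - (∫ x, θ x * w x) ^ 2) ≤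
        ((∫ x, (nonlocalOp β w x + V x * w x) * (φ x ^ 2 * w x)) +
        1 / (4 * Real.pi) * ∫ y, kernel β y * ∫ x, (φ (x + y) - φ x) ^ 2 * (w x * w (x + y))) +
        s * ((1 / (4 * Real.pi)) * (∫ y, kernel β y * incrementForm φ φ y) +
          ∫ x, V x * φ x * φ x) := by
    intro s hs
    set a : Plane → ℝ := fun x => √(w x ^ 2 + s) with ha
    have ca : ContDiff ℝ 2 a :=
      ContDiff.sqrt (by fun_prop) fun x => by positivity
    have caC := ca.continuous
    set η : Plane → ℝ := fun x => φ x * a x with hη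
    have hηd : ContDiff ℝ 2 η := hφ.mul ca
    have hηs : HasCompactSupport η := hφs.mul_right
    obtain ⟨Bη, hBη⟩ := hηd.continuous.bounded_above_of_compact_support hηs
    obtain ⟨iη, iKη, eη⟩ := nonlocalOp_pairing hβ (isLocC1Holder_of_contDiff hηd) hBη
      hηd.continuous hηs
    have iVη : Integrable fun x => V x * η x * η x :=
      integrable_mul_of_hasCompactSupport (by fun_prop) hηd.continuous hηs
    have stab := hst η hηd hηs
    have es : ∫ x, (nonlocalOp β η x + V x * η x) * η x =
        (∫ x, nonlocalOp β η x * η x) + ∫ x, V x * η x * η x := by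
      rw [← integral_add iη iVη]; congr 1; funext x; ring
    have eVη : ∫ x, V x * η x * η x =
        (∫ x, V x * w x * (φ x ^ 2 * w x)) + s * ∫ x, V x * φ x * φ x := by
      rw [← integral_const_mul, ← integral_add iVw (iVφ.const_mul s)]
      congr 1; funext x
      have : √(w x ^ 2 + s) ^ 2 = w x ^ 2 + s := Real.sq_sqrt (by positivity)
      simp only [hη, ha]
      linear_combination V x * φ x ^ 2 * this
    have ew' : ∫ x, (nonlocalOp β w x + V x * w x) * (φ x ^ 2 * w x) =
        (∫ x, nonlocalOp β w x * (φ x ^ 2 * w x)) + ∫ x, V x * w x * (φ x ^ 2 * w x) := by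
      rw [← integral_add iw iVw]; congr 1; funext x; ring
    set T : Plane → ℝ := fun y => ∫ x, φ x * φ (x + y) * (a x * a (x + y) - w x * w (x + y) - s)
      with hT
    have hid : ∀ y, incrementForm η η y = incrementForm w (fun x => φ x ^ 2 * w x) y +
        (∫ x, (φ (x + y) - φ x) ^ 2 * (w x * w (x + y))) + s * incrementForm φ φ y - 2 * T y :=
      fun y => incrementForm_regularized cφ hφs cw hs.le y
    have eKT : (fun y => kernel β y * T y) = fun y => (1 / 2) *
        (kernel β y * incrementForm w (fun x => φ x ^ 2 * w x) y +
          kernel β y * (∫ x, (φ (x + y) - φ x) ^ 2 * (w x * w (x + y))) +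
          s * (kernel β y * incrementForm φ φ y) - kernel β y * incrementForm η η y) := by
      funext y; rw [hid]; ring
    have iKT : Integrable fun y => kernel β y * T y := by
      rw [eKT]; exact (((iKw.add iPy).add (iKφ.const_mul s)).sub iKη).const_mul _
    have eKTi : ∫ y, kernel β y * T y = (1 / 2) *
        ((∫ y, kernel β y * incrementForm w (fun x => φ x ^ 2 * w x) y) +
          (∫ y, kernel β y * (∫ x, (φ (x + y) - φ x) ^ 2 * (w x * w (x + y)))) +
          s * (∫ y, kernel β y * incrementForm φ φ y) -
          ∫ y, kernel β y * incrementForm η η y) := by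
      rw [eKT, integral_const_mul, integral_add_add_sub iKw iPy (iKφ.const_mul s) iKη,
        integral_const_mul]
    have hgap : ∀ x y, |w x| * |w (x + y)| - w x * w (x + y) ≤
        a x * a (x + y) - w x * w (x + y) - s := fun x y => by
      have := abs_mul_abs_add_le_sqrt_mul_sqrt hs.le (w x) (w (x + y))
      simp only [ha]; linarith
    have hgap0 : ∀ x y, 0 ≤ |w x| * |w (x + y)| - w x * w (x + y) := fun x y => by
      rw [← abs_mul, sub_nonneg]; exact le_abs_self _
    have hT0 : ∀ y, 0 ≤ T y := fun y => integral_nonneg fun x =>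
      mul_nonneg (mul_nonneg (hφ1 x).1 (hφ1 (x + y)).1) ((hgap0 x y).trans (hgap x y))
    have iT : ∀ y, Integrable fun x =>
        φ x * φ (x + y) * (a x * a (x + y) - w x * w (x + y) - s) := fun y => by
      have : Integrable fun x =>
          (φ (x + y) * (a x * a (x + y) - w x * w (x + y) - s)) * φ x :=
        integrable_mul_of_hasCompactSupport (by fun_prop) cφ hφs
      refine this.congr (Eventually.of_forall fun x => ?_)
      simp only; ring
    have lower : c / 8 * ((∫ x, θ x * |w x|) ^ 2 - (∫ x, θ x * w x) ^ 2) ≤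
        ∫ y, kernel β y * T y := by
      rw [← eA, ← eW, ← integral_sub iA.integral_prod_right iW.integral_prod_right,
        ← integral_const_mul]
      refine integral_mono_ae ((iA.integral_prod_right.sub iW.integral_prod_right).const_mul _)
        iKT ?_
      have hne : ∀ᵐ y : Plane, y ≠ 0 := by
        simp [ae_iff]
      filter_upwards [iA.prod_left_ae, iW.prod_left_ae, hne] with y hAy hWy hy
      rw [← integral_sub hAy hWy]
      have hpos : 0 < ‖y‖ := norm_pos_iff.2 hy
      have hint0 : 0 ≤ ∫ x, (θ x * |w x| * (θ (x + y) * |w (x + y)|) -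
          θ x * w x * (θ (x + y) * w (x + y))) := integral_nonneg fun x => by
        have := mul_nonneg (mul_nonneg (hθ x).1 (hθ (x + y)).1) (hgap0 x y)
        simp only [Pi.zero_apply]; linarith
      have hTle : ∫ x, (θ x * |w x| * (θ (x + y) * |w (x + y)|) -
          θ x * w x * (θ (x + y) * w (x + y))) ≤ T y := by
        refine integral_mono (hAy.sub hWy) (iT y) fun x => ?_
        have e1 : θ x * θ (x + y) ≤ φ x * φ (x + y) :=
          mul_le_mul (hθ x).2 (hθ _).2 (hθ _).1 (hφ1 x).1
        have e2 := mul_le_mul e1 (hgap x y) (hgap0 x y)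
          (mul_nonneg (hφ1 x).1 (hφ1 (x + y)).1)
        simp only at e2 ⊢
        linarith
      -- If |y| ≥ 2, then x and x + y cannot both lie in the unit disk, so the θ-integral vanishes;
      -- otherwise K ≥ c/8.
      rcases lt_or_ge ‖y‖ 2 with hy2 | hy2
      · have hk : c / 8 ≤ kernel β y := by
          refine le_trans ?_ (hcK y hy)
          gcongr
          calc ‖y‖ ^ 3 ≤ 2 ^ 3 := by gcongr
            _ = 8 := by norm_num
        exact mul_le_mul hk hTle hint0 (kernel_nonneg h1 h2 y)
      · have : ∫ x, (θ x * |w x| * (θ (x + y) * |w (x + y)|) -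
            θ x * w x * (θ (x + y) * w (x + y))) = 0 := by
          rw [← integral_zero Plane ℝ]
          congr 1; funext x
          by_cases hx : x ∈ Metric.ball (0 : Plane) 1
          · have : x + y ∉ Metric.ball (0 : Plane) 1 := fun h => by
              rw [mem_ball_zero_iff] at h hx
              have := norm_sub_le (x + y) x
              rw [add_sub_cancel_left] at this
              linarith
            rw [hθ0 _ this]; ring
          · rw [hθ0 _ hx]; ring
        rw [this, mul_zero]
        exact mul_nonneg (kernel_nonneg h1 h2 y) (hT0 y)
    rw [es, eη, eVη] at stab
    rw [ew', ew]
    have hκ : 0 < 1 / (4 * Real.pi) := by positivity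
    generalize 1 / (4 * Real.pi) = κ at *
    have l2 := mul_le_mul_of_nonneg_left lower (by positivity : 0 ≤ 2 * κ)
    rw [eKTi] at l2
    linarith
  -- Choosing s = ε/(|Z| + 1) makes the error at most ε, whatever the sign of its coefficient Z.
  refine le_of_forall_pos_le_add fun ε hε => ?_
  set Z := (1 / (4 * Real.pi)) * (∫ y, kernel β y * incrementForm φ φ y) +
          ∫ x, V x * φ x * φ x with hZ
  refine (main (ε / (|Z| + 1)) (by positivity)).trans ?_
  gcongr
  rw [div_mul_eq_mul_div, div_le_iff₀ (by positivity)]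
  nlinarith [le_abs_self Z]

/-! ### Mollification and commutation with the operator. -/

/-- A sequence of bump functions concentrating at the origin. -/
def bump (n : ℕ) : ContDiffBump (0 : Plane) where
  rIn := 1 / ((n : ℝ) + 1) / 2
  rOut := 1 / ((n : ℝ) + 1)
  rIn_pos := by positivity
  rIn_lt_rOut := half_lt_self (by positivity)

/-- The normalized bump functions. -/
def mollifier (n : ℕ) : Plane → ℝ := (bump n).normed volume

/-- Mollification of a function. -/
def mollify (n : ℕ) (f : Plane → ℝ) (x : Plane) : ℝ := ∫ t, mollifier n t * f (x - t)

theorem contDiff_mollifier (n : ℕ) : ContDiff ℝ 2 (mollifier n) := (bump n).contDiff_normed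

theorem hasCompactSupport_mollifier (n : ℕ) : HasCompactSupport (mollifier n) :=
  (bump n).hasCompactSupport_normed

theorem mollify_eq_convolution (n : ℕ) (f : Plane → ℝ) :
    mollify n f = convolution (mollifier n) f (ContinuousLinearMap.lsmul ℝ ℝ) volume := rfl

theorem mollify_tendsto {f : Plane → ℝ} (hf : Continuous f) (x : Plane) :
    Tendsto (fun n => mollify n f x) atTop (𝓝 (f x)) :=
  ContDiffBump.convolution_tendsto_right_of_continuous (φ := bump)
    tendsto_one_div_add_atTop_nhds_zero_nat hf x

theorem contDiff_mollify (n : ℕ) {f : Plane → ℝ} (hf : Continuous f) {m : ℕ∞} :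
    ContDiff ℝ m (mollify n f) := by
  rw [mollify_eq_convolution]
  exact (hasCompactSupport_mollifier n).contDiff_convolution_left _ (bump n).contDiff_normed
    hf.locallyIntegrable

/-- The mollifier is a probability density supported within distance 1/(n+1) ≤ 1, so the unit ball
serves for every n. -/
theorem abs_mollify_le (n : ℕ) {f : Plane → ℝ} {x : Plane} {L : ℝ}
    (hL : ∀ z ∈ Metric.ball x 1, |f z| ≤ L) : |mollify n f x| ≤ L := by
  have hint : ∫ t, mollifier n t = 1 := (bump n).integral_normed
  have hi : Integrable (mollifier n) := (bump n).integrable_normed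
  have := norm_integral_le_of_norm_le (f := fun t => mollifier n t * f (x - t))
    (hi.mul_const L) (Eventually.of_forall fun t => ?_)
  · rwa [integral_mul_const, hint, one_mul] at this
  · have h0 : 0 ≤ mollifier n t := (bump n).nonneg_normed t
    rw [norm_mul, Real.norm_of_nonneg h0, Real.norm_eq_abs]
    by_cases ht : mollifier n t = 0
    · simp [ht]
    · have hmem : t ∈ Metric.ball (0 : Plane) (1 / ((n : ℝ) + 1)) := by
        have : t ∈ Function.support ((bump n).normed volume) := ht
        rwa [(bump n).support_normed_eq] at this
      have h1 : 1 / ((n : ℝ) + 1) ≤ 1 := by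
        rw [div_le_one (by positivity)]; linarith [n.cast_nonneg (α := ℝ)]
      gcongr
      refine hL _ ?_
      rw [mem_ball_zero_iff] at hmem
      rw [mem_ball_iff_norm, sub_sub_cancel_left, norm_neg]
      linarith

/-- With the derivative on the mollifier, ∂_v of the mollified u is a convolution of u itself, so
`nonlocalOp_convolution` applies without regularity of ∂_v u. -/
theorem fderiv_mollify_eq (n : ℕ) {f : Plane → ℝ} (hf : Continuous f) (x v : Plane) :
    fderiv ℝ (mollify n f) x v = ∫ t, fderiv ℝ (mollifier n) t v * f (x - t) := by
  have hd := (hasCompactSupport_mollifier n).hasFDerivAt_convolution_left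
    (ContinuousLinearMap.lsmul ℝ ℝ) ((contDiff_mollifier n).of_le (by norm_num))
    (hf.locallyIntegrable (μ := volume)) x
  rw [← mollify_eq_convolution] at hd
  rw [hd.fderiv]
  have hc : ConvolutionExistsAt (fderiv ℝ (mollifier n)) f x
      ((ContinuousLinearMap.lsmul ℝ ℝ).precompL Plane) (volume : Measure Plane) :=
    ((hasCompactSupport_mollifier n).fderiv (𝕜 := ℝ)).convolutionExists_left _
      ((contDiff_mollifier n).continuous_fderiv (by norm_num)) hf.locallyIntegrable x
  rw [convolution, ContinuousLinearMap.integral_apply hc]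
  rfl

theorem integral_fderiv_mul {ρ g : Plane → ℝ} (hρ : ContDiff ℝ 1 ρ) (hρs : HasCompactSupport ρ)
    (hg : ContDiff ℝ 1 g) (v : Plane) :
    ∫ t, fderiv ℝ ρ t v * g t = -∫ t, ρ t * fderiv ℝ g t v := by
  have c1 : Continuous fun t => fderiv ℝ ρ t v :=
    (hρ.continuous_fderiv (by norm_num)).clm_apply continuous_const
  have c2 : Continuous fun t => fderiv ℝ g t v :=
    (hg.continuous_fderiv (by norm_num)).clm_apply continuous_const
  have s1 : HasCompactSupport fun t => fderiv ℝ ρ t v := hρs.fderiv_apply (𝕜 := ℝ) v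
  rw [integral_mul_fderiv_eq_neg_fderiv_mul_of_integrable (𝕜 := ℝ)
    (μ := (volume : Measure Plane)) (f := ρ) (g := g) (v := v)
    ((c1.mul hg.continuous).integrable_of_hasCompactSupport s1.mul_right)
    ((hρ.continuous.mul c2).integrable_of_hasCompactSupport hρs.mul_right)
    ((hρ.continuous.mul hg.continuous).integrable_of_hasCompactSupport hρs.mul_right)
    (fun t _ => hρ.differentiable (by norm_num) t) (fun t _ => hg.differentiable (by norm_num) t),
    neg_neg]

theorem integral_fderiv_mul_comp_sub {ρ f : Plane → ℝ} (hρ : ContDiff ℝ 1 ρ)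
    (hρs : HasCompactSupport ρ) (hf : ContDiff ℝ 1 f) (x v : Plane) :
    ∫ t, fderiv ℝ ρ t v * f (x - t) = ∫ t, ρ t * fderiv ℝ f (x - t) v := by
  have hd : ∀ t, fderiv ℝ (fun t => f (x - t)) t v = -fderiv ℝ f (x - t) v := fun t => by
    have : HasFDerivAt (fun t => f (x - t))
        ((fderiv ℝ f (x - t)).comp (-ContinuousLinearMap.id ℝ Plane)) t :=
      (hf.differentiable (by norm_num) (x - t)).hasFDerivAt.comp t
        ((hasFDerivAt_id t).const_sub x)
    rw [this.fderiv]; simp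
  have hg : ContDiff ℝ 1 fun t => f (x - t) := hf.comp (contDiff_const.sub contDiff_id)
  rw [integral_fderiv_mul hρ hρs hg v, ← integral_neg]
  congr 1; funext t
  rw [hd t]; ring

theorem fderiv_mollify (n : ℕ) {f : Plane → ℝ} (hf : ContDiff ℝ 1 f) (x v : Plane) :
    fderiv ℝ (mollify n f) x v = mollify n (fun z => fderiv ℝ f z v) x := by
  rw [fderiv_mollify_eq n hf.continuous, integral_fderiv_mul_comp_sub
    ((contDiff_mollifier n).of_le (by norm_num)) (hasCompactSupport_mollifier n) hf]
  rfl

theorem norm_fderiv_mollify_le (n : ℕ) {f : Plane → ℝ} (hf : ContDiff ℝ 1 f) {x : Plane} {L : ℝ}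
    (hL : ∀ z ∈ Metric.ball x 1, ‖fderiv ℝ f z‖ ≤ L) : ‖fderiv ℝ (mollify n f) x‖ ≤ L := by
  refine ContinuousLinearMap.opNorm_le_bound _
    ((norm_nonneg _).trans (hL x (Metric.mem_ball_self one_pos))) fun v => ?_
  rw [fderiv_mollify n hf]
  refine abs_mollify_le n fun z hz => ?_
  refine ((fderiv ℝ f z).le_opNorm v).trans ?_
  gcongr
  exact hL z hz

/-- The gradient of u need not be bounded on the plane, but that of its mollification is. The bound
depends on n, which is harmless because no later estimate retains it. -/
theorem exists_bound_fderiv_mollify (n : ℕ) {f : Plane → ℝ} (hf : Continuous f) {M : ℝ}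
    (hM : ∀ x, |f x| ≤ M) (v : Plane) : ∃ B : ℝ, ∀ x, |fderiv ℝ (mollify n f) x v| ≤ B := by
  have c1 : Continuous fun t => fderiv ℝ (mollifier n) t v :=
    ((contDiff_mollifier n).continuous_fderiv (by norm_num)).clm_apply continuous_const
  have s1 : HasCompactSupport fun t => fderiv ℝ (mollifier n) t v :=
    (hasCompactSupport_mollifier n).fderiv_apply (𝕜 := ℝ) v
  have i1 : Integrable fun t => fderiv ℝ (mollifier n) t v := c1.integrable_of_hasCompactSupport s1
  refine ⟨∫ t, |fderiv ℝ (mollifier n) t v| * M, fun x => ?_⟩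
  rw [fderiv_mollify_eq n hf, ← Real.norm_eq_abs]
  refine norm_integral_le_of_norm_le (i1.abs.mul_const M) (Eventually.of_forall fun t => ?_)
  rw [norm_mul, Real.norm_eq_abs, Real.norm_eq_abs]
  gcongr
  exact hM _

/-- The nonlocal operator commutes with convolution by a compactly supported function. -/
theorem nonlocalOp_convolution {β : ℝ} (hβ : 0 < β) {u ψ : Plane → ℝ} (hu : IsLocC1Holder u)
    {M : ℝ} (hM : ∀ x, |u x| ≤ M) (hψ : Continuous ψ) (hψs : HasCompactSupport ψ) (x : Plane) :
    nonlocalOp β (fun x => ∫ t, ψ t * u (x - t)) x = ∫ t, ψ t * nonlocalOp β u (x - t) := by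
  obtain ⟨A, -, hA⟩ := exists_kernel_le hβ
  have cu := hu.1.continuous
  have hζs : HasCompactSupport fun z => ψ (x - z) :=
    hψs.comp_homeomorph (Homeomorph.subLeft x)
  have hi := integrable_secondDiff_prod (measurable_kernel hβ) hA hu hM
    (ζ := fun z => ψ (x - z)) (by fun_prop) hζs
  have hconv : ∀ f : Plane → ℝ, ∫ t, ψ t * f (x - t) = ∫ z, ψ (x - z) * f z := fun f => by
    rw [← integral_sub_left_eq_self (fun t => ψ t * f (x - t)) volume x]
    simp only [sub_sub_cancel]
  have hint : ∀ z, Integrable fun t => ψ t * u (z - t) := fun z =>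
    (Continuous.mul hψ (by fun_prop)).integrable_of_hasCompactSupport hψs.mul_right
  have esd : ∀ y, secondDiff (fun x => ∫ t, ψ t * u (x - t)) x y =
      ∫ z, ψ (x - z) * secondDiff u z y := fun y => by
    rw [← hconv fun z => secondDiff u z y]
    simp only [secondDiff]
    have hadd : Integrable fun t => ψ t * u (x + y - t) + ψ t * u (x - y - t) :=
      (hint _).add (hint _)
    rw [← integral_const_mul, ← integral_add (hint _) (hint _),
      ← integral_sub hadd ((hint _).const_mul 2)]
    congr 1; funext t
    rw [show x + y - t = x - t + y by abel, show x - y - t = x - t - y by abel]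
    ring
  rw [hconv (nonlocalOp β u), nonlocalOp_eq]
  simp only [nonlocalOp_eq, esd]
  have e1 : ∀ y, (∫ z, ψ (x - z) * secondDiff u z y) * kernel β y =
      ∫ z, secondDiff u z y * kernel β y * ψ (x - z) := fun y => by
    rw [← integral_mul_const]; congr 1; funext z; ring
  have e2 : ∀ z, ψ (x - z) * (-(1 / (4 * Real.pi)) * ∫ y, secondDiff u z y * kernel β y) =
      -(1 / (4 * Real.pi)) * ∫ y, secondDiff u z y * kernel β y * ψ (x - z) := fun z => by
    rw [integral_mul_const]; ring
  simp only [e1, e2]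
  rw [integral_const_mul]
  congr 1
  exact (integral_integral_swap hi).symm

/-! ### Energy in increment variables and the limit of the mollified estimates. -/

theorem integrableOn_energy_density {β : ℝ} (hβ : 0 < β) {u : Plane → ℝ} (hu : ContDiff ℝ 1 u)
    {M : ℝ} (hM : ∀ x, |u x| ≤ M) (r : ℝ) :
    IntegrableOn (fun p : Plane × Plane => (u (p.1 + p.2) - u p.1) ^ 2 * kernel β p.2) (strip r)
      (volume.prod volume) := by
  obtain ⟨A, hA, hK⟩ := exists_kernel_le hβ
  have cu := hu.continuous
  refine Integrable.mono' (Integrable.const_mul (integrableOn_increment_sq hu hM r) A)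
    (Measurable.aestronglyMeasurable ?_) (Eventually.of_forall fun p => ?_)
  · exact (Continuous.measurable (by fun_prop)).mul ((measurable_kernel hβ).comp measurable_snd)
  · rw [norm_mul, Real.norm_of_nonneg (sq_nonneg _), Real.norm_eq_abs]
    calc (u (p.1 + p.2) - u p.1) ^ 2 * |kernel β p.2|
        ≤ (u (p.1 + p.2) - u p.1) ^ 2 * (A / ‖p.2‖ ^ 3) := by gcongr; exact hK _
      _ = _ := by ring

/-- The measure-preserving map (x, y) ↦ (x + y, x) turns pairs not both outside the disk into the
strip. Integrability on the strip makes the energy finite for every bounded C¹ function. -/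
theorem energy_eq {β : ℝ} (h1 : 2 / 3 < β) (h2 : β < 3 / 2) {u : Plane → ℝ}
    (hu : ContDiff ℝ 1 u) {M : ℝ} (hM : ∀ x, |u x| ≤ M) (R : ℝ) :
    energy β u R = ENNReal.ofReal (∫ p in strip R, (u (p.1 + p.2) - u p.1) ^ 2 * kernel β p.2
      ∂(volume.prod volume)) := by
  have hβ : 0 < β := by linarith
  have hmp : MeasurePreserving (fun z : Plane × Plane => (z.1 + z.2, z.1))
      (volume.prod volume) (volume.prod volume) :=
    Measure.measurePreserving_swap.comp
      (measurePreserving_prod_add (volume : Measure Plane) (volume : Measure Plane))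
  have hemb : MeasurableEmbedding fun z : Plane × Plane => (z.1 + z.2, z.1) :=
    (Homeomorph.measurableEmbedding
      ⟨⟨fun z : Plane × Plane => (z.1 + z.2, z.1), fun z => (z.2, z.1 - z.2),
        fun z => by simp, fun z => by simp⟩, by fun_prop, by fun_prop⟩)
  rw [ofReal_integral_eq_lintegral_ofReal (integrableOn_energy_density hβ hu hM R)
    (Eventually.of_forall fun p => mul_nonneg (sq_nonneg _) (kernel_nonneg h1 h2 _)), energy,
    Measure.volume_eq_prod, ← hmp.setLIntegral_comp_preimage_emb hemb]
  have hset : (fun z : Plane × Plane => (z.1 + z.2, z.1)) ⁻¹'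
      ((Metric.ball (0 : Plane) R)ᶜ ×ˢ (Metric.ball (0 : Plane) R)ᶜ)ᶜ = strip R := by
    ext p
    simp only [strip, Set.mem_preimage, Set.mem_compl_iff, Set.mem_prod, Set.mem_ofPred_eq]
    tauto
  rw [hset]
  simp only [add_sub_cancel_left, sq_abs]

theorem exists_strip_integral_le_energy {β : ℝ} (h1 : 2 / 3 < β) (h2 : β < 3 / 2) :
    ∃ C : ℝ, 0 ≤ C ∧ ∀ (u : Plane → ℝ) (M R : ℝ), ContDiff ℝ 1 u → (∀ x, |u x| ≤ M) →
      energy β u R < ⊤ ∧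
      ∫ p in strip R, (u (p.1 + p.2) - u p.1) ^ 2 / ‖p.2‖ ^ 3 ∂(volume.prod volume) ≤
        C * (energy β u R).toReal := by
  obtain ⟨c, hc, hcK⟩ := exists_le_kernel h1 h2
  have hβ : 0 < β := by linarith
  refine ⟨c⁻¹, by positivity, fun u M R hu hM => ?_⟩
  rw [energy_eq h1 h2 hu hM R]
  refine ⟨ENNReal.ofReal_lt_top, ?_⟩
  rw [ENNReal.toReal_ofReal (integral_nonneg fun p =>
    mul_nonneg (sq_nonneg _) (kernel_nonneg h1 h2 _)), ← integral_const_mul]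
  refine integral_mono (integrableOn_increment_sq hu hM R)
    (Integrable.const_mul (integrableOn_energy_density hβ hu hM R) _) fun p => ?_
  simp only
  rcases eq_or_ne p.2 0 with h0 | h0
  · simp [h0]
  · have := hcK _ h0
    calc (u (p.1 + p.2) - u p.1) ^ 2 / ‖p.2‖ ^ 3
        = c⁻¹ * ((u (p.1 + p.2) - u p.1) ^ 2 * (c / ‖p.2‖ ^ 3)) := by field_simp
      _ ≤ _ := by gcongr

theorem tendsto_integral_of_local_bound {θ : Plane → ℝ} {f : ℕ → Plane → ℝ} {g : Plane → ℝ}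
    {r L : ℝ} (hθ : Integrable θ) (h0 : ∀ x, x ∉ Metric.ball (0 : Plane) r → θ x = 0)
    (hf : ∀ n, Continuous (f n)) (hL : ∀ n, ∀ x ∈ Metric.ball (0 : Plane) r, |f n x| ≤ L)
    (hlim : ∀ x, Tendsto (fun n => f n x) atTop (𝓝 (g x))) :
    Tendsto (fun n => ∫ x, θ x * f n x) atTop (𝓝 (∫ x, θ x * g x)) := by
  refine tendsto_integral_of_dominated_convergence (fun x => |θ x| * L)
    (fun n => hθ.aestronglyMeasurable.mul (hf n).aestronglyMeasurable) (hθ.abs.mul_const L)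
    (fun n => Eventually.of_forall fun x => ?_)
    (Eventually.of_forall fun x => (hlim x).const_mul _)
  rw [norm_mul, Real.norm_eq_abs, Real.norm_eq_abs]
  by_cases hx : x ∈ Metric.ball (0 : Plane) r
  · gcongr; exact hL n x hx
  · simp [h0 x hx]

theorem tendsto_strip_integral_mollify {u : Plane → ℝ} (hu : ContDiff ℝ 1 u) {M : ℝ}
    (hM : ∀ x, |u x| ≤ M) (r : ℝ) :
    Tendsto (fun n => ∫ p in strip r, (mollify n u (p.1 + p.2) - mollify n u p.1) ^ 2 / ‖p.2‖ ^ 3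
        ∂(volume.prod volume)) atTop
      (𝓝 (∫ p in strip r, (u (p.1 + p.2) - u p.1) ^ 2 / ‖p.2‖ ^ 3 ∂(volume.prod volume))) := by
  obtain ⟨L, hL0, hL⟩ := exists_fderiv_bound hu (r + 1 + 1)
  have hmc : ∀ n, ContDiff ℝ 1 (mollify n u) := fun n =>
    contDiff_mollify n hu.continuous (m := 1)
  have hmM : ∀ n x, |mollify n u x| ≤ M := fun n x => abs_mollify_le n fun z _ => hM z
  have hball : ∀ z ∈ Metric.ball (0 : Plane) (r + 1), ∀ z' ∈ Metric.ball z 1,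
      z' ∈ Metric.ball (0 : Plane) (r + 1 + 1) := fun z hz z' hz' => by
    rw [mem_ball_zero_iff] at hz ⊢
    rw [mem_ball_iff_norm] at hz'
    have := norm_add_le (z' - z) z
    rw [sub_add_cancel] at this
    linarith
  refine tendsto_integral_of_dominated_convergence
    (fun p => (L ^ 2 + 4 * M ^ 2) * cubicWeight 1 p.2)
    (fun n => (integrableOn_increment_sq (hmc n) (hmM n) r).aestronglyMeasurable)
    (integrableOn_strip ((integrable_cubicWeight one_pos).const_mul _) r) (fun n => ?_)
    (Eventually.of_forall fun p => ?_)
  · filter_upwards [ae_restrict_mem (measurableSet_strip r)] with p hp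
    rw [Real.norm_of_nonneg (by positivity)]
    exact increment_sq_le (hmc n) (hmM n) (fun z hz => norm_fderiv_mollify_le n hu fun z' hz' =>
      hL z' (hball z hz z' hz')) hp
  · exact (((mollify_tendsto hu.continuous _).sub (mollify_tendsto hu.continuous _)).pow 2).div_const
      _

/-- The stability and integration by parts bounds are applied to the mollified u, whose derivative
satisfies the linearised equation up to an error that vanishes locally in the limit. The weight θ is
left free because the two conclusions need different choices. -/
theorem exists_weighted_product_bound {β : ℝ} (h1 : 2 / 3 < β) (h2 : β < 3 / 2) :
    ∃ C : ℝ, 0 ≤ C ∧ ∀ (W : ℝ → ℝ) (u φ θ : Plane → ℝ) (v : Plane) (M r Λ : ℝ),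
      ContDiff ℝ 2 W → IsSolution β W u → IsStable β W u → (∀ x, |u x| ≤ M) → ‖v‖ = 1 →
      ContDiff ℝ 2 φ → (∀ x, 0 ≤ φ x ∧ φ x ≤ 1) → tsupport φ ⊆ Metric.ball (0 : Plane) r →
      (∀ x, ‖fderiv ℝ φ x‖ ≤ Λ) → Measurable θ → (∀ x, 0 ≤ θ x ∧ θ x ≤ φ x) →
      (∀ x, x ∉ Metric.ball (0 : Plane) 1 → θ x = 0) →
      (∫ x, θ x * |fderiv ℝ u x v|) ^ 2 - (∫ x, θ x * fderiv ℝ u x v) ^ 2 ≤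
        C * Λ ^ 2 * (energy β u r).toReal := by
  have hβ : 0 < β := by linarith
  obtain ⟨c, hc, hstab⟩ := exists_stability_product_bound h1 h2
  obtain ⟨C1, hC1, hibp⟩ := exists_quadratic_increment_le h1 h2
  obtain ⟨C2, hC2, hen⟩ := exists_strip_integral_le_energy h1 h2
  have hπ := Real.pi_pos
  refine ⟨c⁻¹ * (1 / (4 * Real.pi) * (C1 * C2)), by positivity, ?_⟩
  intro W u φ θ v M r Λ hW hsol hst hM hv hφ hφ1 hs hΛ hθm hθ hθ0
  have hu := hsol.regular.1
  have cu := hu.continuous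
  have hφs : HasCompactSupport φ :=
    (isCompact_closedBall (0 : Plane) r).of_isClosed_subset (isClosed_tsupport φ)
      (hs.trans Metric.ball_subset_closedBall)
  have hφB : ∀ x, |φ x| ≤ 1 := fun x => by rw [abs_of_nonneg (hφ1 x).1]; exact (hφ1 x).2
  have hW1 : ContDiff ℝ 1 (deriv W) :=
    ((contDiff_succ_iff_deriv (n := 1)).1 (by simpa [one_add_one_eq_two] using hW)).2.2
  have cW2 : Continuous (deriv (deriv W)) := hW1.continuous_deriv (by norm_num)
  have cw : Continuous fun x => fderiv ℝ u x v :=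
    (hu.continuous_fderiv (by norm_num)).clm_apply continuous_const
  set V : Plane → ℝ := fun x => 1 / √β * deriv (deriv W) (u x) with hV
  have cV : Continuous V := by fun_prop
  set g : Plane → ℝ := fun x => -(V x * fderiv ℝ u x v) with hg
  have cg : Continuous g := by fun_prop
  set w : ℕ → Plane → ℝ := fun n x => fderiv ℝ (mollify n u) x v with hw
  have hwd : ∀ n, ContDiff ℝ 2 (w n) := fun n =>
    ((contDiff_mollify n cu (m := 3)).fderiv_right (m := 2) (by norm_num)).clm_apply contDiff_const
  have hwm : ∀ n x, w n x = mollify n (fun z => fderiv ℝ u z v) x := fun n x =>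
    fderiv_mollify n hu x v
  -- The operator commutes with convolution against ∂_v of the mollifier; after inserting the
  -- equation, the derivative is moved onto W'(u), producing −V ∂_v u.
  have hLw : ∀ n x, nonlocalOp β (w n) x = mollify n g x := fun n x => by
    have e1 : w n = fun x => ∫ t, fderiv ℝ (mollifier n) t v * u (x - t) :=
      funext fun x => fderiv_mollify_eq n cu x v
    have cψ : Continuous fun t => fderiv ℝ (mollifier n) t v :=
      ((contDiff_mollifier n).continuous_fderiv (by norm_num)).clm_apply continuous_const
    rw [e1, nonlocalOp_convolution hβ hsol.regular hM cψ
      ((hasCompactSupport_mollifier n).fderiv_apply (𝕜 := ℝ) v)]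
    simp only [hsol.equation]
    have hf : ContDiff ℝ 1 fun z => -(1 / √β) * deriv W (u z) := contDiff_const.mul (hW1.comp hu)
    rw [integral_fderiv_mul_comp_sub ((contDiff_mollifier n).of_le (by norm_num))
      (hasCompactSupport_mollifier n) hf, mollify]
    congr 1; funext t
    have hd := ((hW1.differentiable (by norm_num) (u (x - t))).hasDerivAt.comp_hasFDerivAt (x - t)
      (hu.differentiable (by norm_num) (x - t)).hasFDerivAt).const_mul (-(1 / √β))
    have hd' : HasFDerivAt (fun z => -(1 / √β) * deriv W (u z))
      (-(1 / √β) • (deriv (deriv W) (u (x - t)) • fderiv ℝ u (x - t))) (x - t) := hd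
    rw [hd'.fderiv]
    simp only [hg, hV, smul_apply, smul_eq_mul]
    ring
  have hstep : ∀ n, c * ((∫ x, θ x * |w n x|) ^ 2 - (∫ x, θ x * w n x) ^ 2) ≤
      (∫ x, φ x ^ 2 * ((mollify n g x + V x * w n x) * w n x)) +
        1 / (4 * Real.pi) * (C1 * Λ ^ 2 *
          ∫ p in strip r, (mollify n u (p.1 + p.2) - mollify n u p.1) ^ 2 / ‖p.2‖ ^ 3
            ∂(volume.prod volume)) := fun n => by
    obtain ⟨B, hB⟩ := exists_bound_fderiv_mollify n cu hM v
    have a1 := hstab V (w n) φ θ B cV hst (hwd n) hB hφ hφs hφ1 hθm hθ hθ0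
    have a2 := hibp (mollify n u) φ v M B r Λ (contDiff_mollify n cu (m := 1))
      (fun x => abs_mollify_le n fun z _ => hM z) hv hB (hφ.of_le (by norm_num)) hφB hs hΛ
    have e : ∫ x, (nonlocalOp β (w n) x + V x * w n x) * (φ x ^ 2 * w n x) =
        ∫ x, φ x ^ 2 * ((mollify n g x + V x * w n x) * w n x) := by
      congr 1; funext x; rw [hLw]; ring
    rw [e] at a1
    refine a1.trans ?_
    gcongr
  have bdd : ∀ {f : Plane → ℝ}, Continuous f → ∀ s : ℝ, ∃ L, 0 ≤ L ∧
      ∀ x ∈ Metric.ball (0 : Plane) s, |f x| ≤ L ∧ ∀ n, |mollify n f x| ≤ L := fun {f} hf s => by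
    obtain ⟨L, hL⟩ := (isCompact_closedBall (0 : Plane) (s + 1)).exists_bound_of_continuousOn
      hf.continuousOn
    have hmem : ∀ x ∈ Metric.ball (0 : Plane) s, ∀ z ∈ Metric.ball x 1, |f z| ≤ L :=
      fun x hx z hz => hL z (by
        rw [mem_ball_zero_iff] at hx
        rw [mem_ball_iff_norm] at hz
        rw [mem_closedBall_zero_iff]
        have := norm_add_le (z - x) x
        rw [sub_add_cancel] at this
        linarith)
    refine ⟨max L 0, le_max_right _ _, fun x hx => ⟨?_, fun n => ?_⟩⟩
    · exact (hmem x hx x (Metric.mem_ball_self one_pos)).trans (le_max_left _ _)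
    · exact (abs_mollify_le n (hmem x hx)).trans (le_max_left _ _)
  have wlim : ∀ x, Tendsto (fun n => w n x) atTop (𝓝 (fderiv ℝ u x v)) := fun x => by
    simp only [hwm]; exact mollify_tendsto cw x
  have cwn : ∀ n, Continuous (w n) := fun n => (hwd n).continuous
  have cgn : ∀ n, Continuous (mollify n g) := fun n =>
    (contDiff_mollify n cg (m := 0)).continuous
  have θint : Integrable θ := by
    refine (hφ.continuous.integrable_of_hasCompactSupport hφs).mono' hθm.aestronglyMeasurable
      (Eventually.of_forall fun x => ?_)
    rw [Real.norm_of_nonneg (hθ x).1]; exact (hθ x).2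
  have lim1 : Tendsto (fun n => ∫ x, θ x * |w n x|) atTop
      (𝓝 (∫ x, θ x * |fderiv ℝ u x v|)) := by
    obtain ⟨L, hL0, hL⟩ := bdd cw 1
    refine tendsto_integral_of_local_bound (L := L) θint hθ0 (fun n => (cwn n).abs)
      (fun n x hx => ?_) fun x => (wlim x).abs
    rw [abs_abs, hwm]; exact (hL x hx).2 n
  have lim2 : Tendsto (fun n => ∫ x, θ x * w n x) atTop (𝓝 (∫ x, θ x * fderiv ℝ u x v)) := by
    obtain ⟨L, hL0, hL⟩ := bdd cw 1
    refine tendsto_integral_of_local_bound (L := L) θint hθ0 cwn (fun n x hx => ?_) wlim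
    rw [hwm]; exact (hL x hx).2 n
  -- The residual Lw_n + Vw_n converges pointwise to g + V ∂_v u = 0, boundedly on the disk of
  -- radius r, which contains the support of φ.
  have lim3 : Tendsto (fun n => ∫ x, φ x ^ 2 * ((mollify n g x + V x * w n x) * w n x)) atTop
      (𝓝 0) := by
    obtain ⟨L, hL0, hL⟩ := bdd cw r
    obtain ⟨L', hL0', hL'⟩ := bdd cg r
    obtain ⟨L'', hL0'', hL''⟩ := bdd cV r
    have := tendsto_integral_of_local_bound (θ := fun x => φ x ^ 2) (r := r)
      (f := fun n x => (mollify n g x + V x * w n x) * w n x)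
      (g := fun x => (g x + V x * fderiv ℝ u x v) * fderiv ℝ u x v) (L := (L' + L'' * L) * L)
      ((hφ.continuous.pow 2).integrable_of_hasCompactSupport (by
        simpa only [sq] using hφs.mul_right (f' := φ)))
      (fun x hx => by simp [(eq_zero_of_tsupport_subset hs x hx).1])
      (fun n => ((cgn n).add (cV.mul (cwn n))).mul (cwn n)) (fun n x hx => ?_)
      (fun x => ((mollify_tendsto cg x).add ((wlim x).const_mul (V x))).mul (wlim x))
    · simpa [hg] using this
    · have b1 : |w n x| ≤ L := by rw [hwm]; exact (hL x hx).2 n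
      have b2 := (hL' x hx).2 n
      have b3 := (hL'' x hx).1
      rw [abs_mul]
      have : |mollify n g x + V x * w n x| ≤ L' + L'' * L := by
        refine (abs_add_le _ _).trans ?_
        rw [abs_mul]
        gcongr
      gcongr
  have lim4 := tendsto_strip_integral_mollify hu hM r
  have key := le_of_tendsto_of_tendsto' (((lim1.pow 2).sub (lim2.pow 2)).const_mul c)
    (lim3.add ((lim4.const_mul (C1 * Λ ^ 2)).const_mul (1 / (4 * Real.pi)))) hstep
  obtain ⟨-, hE⟩ := hen u M r hu hM
  rw [zero_add] at key
  have key2 : c * ((∫ x, θ x * |fderiv ℝ u x v|) ^ 2 - (∫ x, θ x * fderiv ℝ u x v) ^ 2) ≤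
      1 / (4 * Real.pi) * (C1 * Λ ^ 2 * (C2 * (energy β u r).toReal)) := by
    refine key.trans ?_
    gcongr
  rw [← le_div_iff₀' hc] at key2
  refine key2.trans (le_of_eq ?_)
  field_simp

/-! ### Cutoffs and the final estimates. -/

/-- The reference cutoff, equal to `1` on the disk of radius `1/2`. -/
def diskBump : ContDiffBump (0 : Plane) where
  rIn := 1 / 2
  rOut := 3 / 4
  rIn_pos := by norm_num
  rIn_lt_rOut := by norm_num

/-- Rescaling one fixed bump by R gives gradient Λ/R. Its outer radius 3/4 < 1 keeps the closed
support inside the open disk of radius R, and R ≥ 1 keeps the value 1 on the half disk. -/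
theorem exists_disk_cutoff : ∃ Λ : ℝ, 0 ≤ Λ ∧ ∀ R : ℝ, 1 ≤ R → ∃ φ : Plane → ℝ,
    ContDiff ℝ 2 φ ∧ (∀ x, 0 ≤ φ x ∧ φ x ≤ 1) ∧ tsupport φ ⊆ Metric.ball (0 : Plane) R ∧
      (∀ x, ‖fderiv ℝ φ x‖ ≤ Λ / R) ∧ ∀ x ∈ Metric.ball (0 : Plane) (1 / 2), φ x = 1 := by
  have hd : ContDiff ℝ 2 (diskBump : Plane → ℝ) := diskBump.contDiff (n := 2)
  obtain ⟨Λ, hΛ⟩ := (hd.continuous_fderiv (by norm_num)).bounded_above_of_compact_support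
    (diskBump.hasCompactSupport.fderiv (𝕜 := ℝ))
  refine ⟨Λ, (norm_nonneg _).trans (hΛ 0), fun R hR => ?_⟩
  have hR0 : 0 < R := by linarith
  have hn : ∀ x : Plane, ‖R⁻¹ • x‖ = ‖x‖ / R := fun x => by
    rw [norm_smul, Real.norm_of_nonneg (by positivity), div_eq_inv_mul]
  refine ⟨fun x => diskBump (R⁻¹ • x), hd.comp (contDiff_const_smul _),
    fun x => ⟨diskBump.nonneg, diskBump.le_one⟩, ?_, fun x => ?_, fun x hx => ?_⟩
  · have hsub : tsupport (fun x => diskBump (R⁻¹ • x)) ⊆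
        Metric.closedBall (0 : Plane) (3 / 4 * R) := by
      refine closure_minimal (fun x hx => ?_) Metric.isClosed_closedBall
      have h1 : R⁻¹ • x ∈ Metric.ball (0 : Plane) diskBump.rOut := by
        rw [← diskBump.support_eq]; exact hx
      rw [mem_ball_zero_iff, hn, div_lt_iff₀ hR0] at h1
      rw [mem_closedBall_zero_iff]
      exact h1.le
    exact hsub.trans (Metric.closedBall_subset_ball (by linarith))
  · rw [fderiv_comp_smul, norm_smul, Real.norm_of_nonneg (by positivity), div_eq_inv_mul]
    gcongr
    exact hΛ _
  · refine diskBump.one_of_mem_closedBall ?_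
    rw [mem_ball_zero_iff] at hx
    rw [mem_closedBall_zero_iff, hn, div_le_iff₀ hR0]
    change ‖x‖ ≤ 1 / 2 * R
    linarith

/-- This is 4ab = (a + b)² − (a − b)² for the integrals a and b of the positive and negative parts.
-/
theorem posPart_mul_negPart {f : Plane → ℝ} {s : Set Plane} (hf : IntegrableOn f s) :
    4 * ((∫ x in s, max (f x) 0) * ∫ x in s, -min (f x) 0) =
      (∫ x in s, |f x|) ^ 2 - (∫ x in s, f x) ^ 2 := by
  have i1 : IntegrableOn (fun x => max (f x) 0) s := hf.pos_part
  have i2 : IntegrableOn (fun x => -min (f x) 0) s := by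
    refine hf.neg_part.congr (Eventually.of_forall fun x => ?_)
    simp only
    rw [← neg_zero, max_neg_neg]
    simp
  have e1 : ∫ x in s, |f x| = (∫ x in s, max (f x) 0) + ∫ x in s, -min (f x) 0 := by
    rw [← integral_add i1 i2]
    congr 1; funext x
    rcases le_total (f x) 0 with h | h
    · rw [abs_of_nonpos h, max_eq_right h, min_eq_left h]; ring
    · rw [abs_of_nonneg h, max_eq_left h, min_eq_right h]; ring
  have e2 : ∫ x in s, f x = (∫ x in s, max (f x) 0) - ∫ x in s, -min (f x) 0 := by
    rw [← integral_sub i1 i2]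
    congr 1; funext x
    rcases le_total (f x) 0 with h | h
    · rw [max_eq_right h, min_eq_left h]; ring
    · rw [max_eq_left h, min_eq_right h]; ring
  rw [e1, e2]; ring

theorem norm_le_sum_coord (L : Plane →L[ℝ] ℝ) :
    ‖L‖ ≤ |L (EuclideanSpace.single 0 1)| + |L (EuclideanSpace.single 1 1)| := by
  refine L.opNorm_le_bound (by positivity) fun x => ?_
  have hx : x = x 0 • EuclideanSpace.single 0 (1 : ℝ) + x 1 • EuclideanSpace.single 1 (1 : ℝ) := by
    ext i; fin_cases i <;> simp
  have h0 : |x 0| ≤ ‖x‖ := PiLp.norm_apply_le x 0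
  have h1 : |x 1| ≤ ‖x‖ := PiLp.norm_apply_le x 1
  conv_lhs => rw [hx]
  rw [map_add, map_smul, map_smul, smul_eq_mul, smul_eq_mul, Real.norm_eq_abs]
  refine (abs_add_le _ _).trans ?_
  rw [abs_mul, abs_mul, add_mul, mul_comm |L (EuclideanSpace.single 0 1)|,
    mul_comm |L (EuclideanSpace.single 1 1)|]
  gcongr

theorem continuous_fderiv_apply {u : Plane → ℝ} (hu : ContDiff ℝ 1 u) (v : Plane) :
    Continuous fun x => fderiv ℝ u x v :=
  (hu.continuous_fderiv (by norm_num)).clm_apply continuous_const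

theorem integrableOn_ball_of_continuous {f : Plane → ℝ} (hf : Continuous f) (r : ℝ) :
    IntegrableOn f (Metric.ball (0 : Plane) r) :=
  (hf.continuousOn.integrableOn_compact (isCompact_closedBall (0 : Plane) r)).mono_set
    Metric.ball_subset_closedBall

/-- Integration by parts moves the derivative onto φ, leaving only the bound on u. -/
theorem abs_integral_mul_fderiv_le {φ u : Plane → ℝ} (hφ : ContDiff ℝ 1 φ)
    (hs : tsupport φ ⊆ Metric.ball (0 : Plane) 1) {Λ M : ℝ} (hΛ : ∀ x, ‖fderiv ℝ φ x‖ ≤ Λ)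
    (hu : ContDiff ℝ 1 u) (hM : ∀ x, |u x| ≤ M) {v : Plane} (hv : ‖v‖ = 1) :
    |∫ x, φ x * fderiv ℝ u x v| ≤ Λ * M * volume.real (Metric.ball (0 : Plane) 1) := by
  have hφs : HasCompactSupport φ :=
    (isCompact_closedBall (0 : Plane) 1).of_isClosed_subset (isClosed_tsupport φ)
      (hs.trans Metric.ball_subset_closedBall)
  have h := integral_fderiv_mul hφ hφs hu v
  have hΛ0 : 0 ≤ Λ := (norm_nonneg _).trans (hΛ 0)
  rw [← abs_neg, ← h, ← Real.norm_eq_abs, ← setIntegral_eq_integral_of_forall_compl_eq_zero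
    (s := Metric.ball (0 : Plane) 1)
    (fun x hx => by rw [(eq_zero_of_tsupport_subset hs x hx).2]; simp)]
  refine norm_setIntegral_le_of_norm_le_const measure_ball_lt_top fun x _ => ?_
  rw [norm_mul, Real.norm_eq_abs (u x)]
  have := (fderiv ℝ φ x).le_opNorm v
  rw [hv, mul_one] at this
  gcongr
  exacts [this.trans (hΛ x), hM x]

end PeierlsNabarro

end

theorem lemma4p3 (β : ℝ) (hβ₁ : 2 / 3 < β) (hβ₂ : β < 3 / 2) (M : ℝ) :
    ∃ C : ℝ, 0 < C ∧
      ∀ (W : ℝ → ℝ) (u : PeierlsNabarro.Plane → ℝ),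
        ContDiff ℝ 2 W →
        PeierlsNabarro.IsSolution β W u →
        PeierlsNabarro.IsStable β W u →
        (∀ x, |u x| ≤ M) →
        (∀ R : ℝ, 1 ≤ R →
          PeierlsNabarro.energy β u R < ⊤ ∧
          ∀ v : PeierlsNabarro.Plane, ‖v‖ = 1 →
            (∫ x in Metric.ball (0 : PeierlsNabarro.Plane) (1 / 2), max (fderiv ℝ u x v) 0) *
              (∫ y in Metric.ball (0 : PeierlsNabarro.Plane) (1 / 2), -min (fderiv ℝ u y v) 0) ≤
            C * ((PeierlsNabarro.energy β u R).toReal / R ^ 2)) ∧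
        ∫ x in Metric.ball (0 : PeierlsNabarro.Plane) (1 / 2), ‖gradient u x‖ ≤
          C * (1 + √(PeierlsNabarro.energy β u 1).toReal) := by
  open PeierlsNabarro MeasureTheory in
  obtain ⟨C0, hC0, hprod⟩ := exists_weighted_product_bound hβ₁ hβ₂
  obtain ⟨C2, -, hen⟩ := exists_strip_integral_le_energy hβ₁ hβ₂
  obtain ⟨Λ, hΛ0, hcut⟩ := exists_disk_cutoff
  -- The constant is fixed before u is known, so M could be negative here; |M| keeps it nonnegative.
  set D := Λ * |M| * volume.real (Metric.ball (0 : Plane) 1) with hD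
  have hD0 : 0 ≤ D := by positivity
  -- The first summand serves the product estimate, the second the gradient estimate (once for each
  -- coordinate direction), and 1 ensures positivity.
  refine ⟨C0 * Λ ^ 2 + 2 * (D + √(C0 * Λ ^ 2)) + 1, by positivity, ?_⟩
  intro W u hW hsol hst hM
  have hu := hsol.regular.1
  refine ⟨fun R hR => ⟨(hen u M R hu hM).1, fun v hv => ?_⟩, ?_⟩
  · obtain ⟨φ, hφ, hφ1, hs, hΛ, hone⟩ := hcut R hR
    have hR0 : 0 < R := by linarith
    -- The weight θ is the indicator of the half disk, where φ = 1.
    have hb := hprod W u φ ((Metric.ball (0 : Plane) (1 / 2)).indicator 1) v M R (Λ / R) hW hsol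
      hst hM hv hφ hφ1 hs hΛ (measurable_one.indicator measurableSet_ball)
      (fun x => by
        by_cases hx : x ∈ Metric.ball (0 : Plane) (1 / 2)
        · rw [Set.indicator_of_mem hx, hone x hx]; simp
        · rw [Set.indicator_of_notMem hx]; exact ⟨le_rfl, (hφ1 x).1⟩)
      (fun x hx => Set.indicator_of_notMem
        (fun h => hx (Metric.ball_subset_ball (by norm_num) h)) _)
    have hind : ∀ f : Plane → ℝ, ∫ x, (Metric.ball (0 : Plane) (1 / 2)).indicator 1 x * f x =
        ∫ x in Metric.ball (0 : Plane) (1 / 2), f x := fun f => by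
      rw [← integral_indicator measurableSet_ball]
      congr 1; funext x
      by_cases hx : x ∈ Metric.ball (0 : Plane) (1 / 2)
      · rw [Set.indicator_of_mem hx, Set.indicator_of_mem hx, Pi.one_apply, one_mul]
      · rw [Set.indicator_of_notMem hx, Set.indicator_of_notMem hx, zero_mul]
    rw [hind, hind, ← posPart_mul_negPart
      (integrableOn_ball_of_continuous (continuous_fderiv_apply hu v) _)] at hb
    have hE : 0 ≤ (energy β u R).toReal / R ^ 2 := by positivity
    have e : C0 * (Λ / R) ^ 2 * (energy β u R).toReal =
        C0 * Λ ^ 2 * ((energy β u R).toReal / R ^ 2) := by field_simp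
    rw [e] at hb
    have hP : 0 ≤ C0 * Λ ^ 2 * ((energy β u R).toReal / R ^ 2) := by positivity
    have hQ : 0 ≤ (2 * (D + √(C0 * Λ ^ 2)) + 1) * ((energy β u R).toReal / R ^ 2) := by positivity
    linarith
  · obtain ⟨φ, hφ, hφ1, hs, hΛ, hone⟩ := hcut 1 le_rfl
    have hdir : ∀ v : Plane, ‖v‖ = 1 →
        ∫ x in Metric.ball (0 : Plane) (1 / 2), |fderiv ℝ u x v| ≤
          D + √(C0 * Λ ^ 2) * √(energy β u 1).toReal := fun v hv => by
      -- Here θ = φ, so that the signed integral ∫φ ∂_v u can be integrated by parts, which the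
      -- sharp indicator would not allow.
      have hb := hprod W u φ φ v M 1 (Λ / 1) hW hsol hst hM hv hφ hφ1 hs hΛ
        hφ.continuous.measurable (fun x => ⟨(hφ1 x).1, le_rfl⟩)
        (fun x hx => (eq_zero_of_tsupport_subset hs x hx).1)
      have hφs : HasCompactSupport φ :=
        (isCompact_closedBall (0 : Plane) 1).of_isClosed_subset (isClosed_tsupport φ)
          (hs.trans Metric.ball_subset_closedBall)
      have cw := continuous_fderiv_apply hu v
      have hbd := abs_integral_mul_fderiv_le (hφ.of_le (by norm_num)) hs hΛ hu
        (fun x => (hM x).trans (le_abs_self M)) hv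
      rw [div_one] at hb hbd
      have hi : Integrable fun x => φ x * |fderiv ℝ u x v| :=
        (hφ.continuous.mul cw.abs).integrable_of_hasCompactSupport hφs.mul_right
      have hle : ∫ x in Metric.ball (0 : Plane) (1 / 2), |fderiv ℝ u x v| ≤
          ∫ x, φ x * |fderiv ℝ u x v| := by
        refine le_trans (le_of_eq ?_) (setIntegral_le_integral hi
          (Filter.Eventually.of_forall fun x => mul_nonneg (hφ1 x).1 (abs_nonneg _))
          (s := Metric.ball (0 : Plane) (1 / 2)))
        exact setIntegral_congr_fun measurableSet_ball fun x hx => by simp [hone x hx]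
      refine hle.trans ?_
      rw [← Real.sqrt_mul (by positivity)]
      set X := ∫ x, φ x * |fderiv ℝ u x v|
      set Y := ∫ x, φ x * fderiv ℝ u x v
      have hP : 0 ≤ C0 * Λ ^ 2 * (energy β u 1).toReal := by positivity
      have hsq := Real.sq_sqrt hP
      have hroot := Real.sqrt_nonneg (C0 * Λ ^ 2 * (energy β u 1).toReal)
      -- With P the energy term, X² ≤ Y² + P ≤ D² + P ≤ (D + √P)².
      refine abs_le_of_sq_le_sq' ?_ (by positivity) |>.2
      have hY : Y ^ 2 ≤ D ^ 2 := sq_le_sq' (by linarith [(abs_le.1 hbd).1]) (abs_le.1 hbd).2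
      nlinarith
    have cgrad : ∀ x, ‖gradient u x‖ ≤ |fderiv ℝ u x (EuclideanSpace.single 0 1)| +
        |fderiv ℝ u x (EuclideanSpace.single 1 1)| := fun x => by
      rw [gradient, LinearIsometryEquiv.norm_map]
      exact norm_le_sum_coord _
    have i0 := integrableOn_ball_of_continuous
      (continuous_fderiv_apply hu (EuclideanSpace.single 0 1)).abs (1 / 2)
    have i1 := integrableOn_ball_of_continuous
      (continuous_fderiv_apply hu (EuclideanSpace.single 1 1)).abs (1 / 2)
    have hsum : ∫ x in Metric.ball (0 : Plane) (1 / 2), ‖gradient u x‖ ≤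
        (∫ x in Metric.ball (0 : Plane) (1 / 2), |fderiv ℝ u x (EuclideanSpace.single 0 1)|) +
        ∫ x in Metric.ball (0 : Plane) (1 / 2), |fderiv ℝ u x (EuclideanSpace.single 1 1)| := by
      rw [← integral_add i0 i1]
      exact integral_mono_of_nonneg (Filter.Eventually.of_forall fun x => norm_nonneg _)
        (i0.add i1) (Filter.Eventually.of_forall cgrad)
    have d0 := hdir (EuclideanSpace.single 0 1) (by simp)
    have d1 := hdir (EuclideanSpace.single 1 1) (by simp)
    have hs0 := Real.sqrt_nonneg (energy β u 1).toReal
    have hc0 := Real.sqrt_nonneg (C0 * Λ ^ 2)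
    have hcc : 0 ≤ C0 * Λ ^ 2 := by positivity
    nlinarith [mul_nonneg hD0 hs0, mul_nonneg hcc hs0, mul_nonneg hc0 hs0]
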